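/- We use the following deterministic $\mathsf{CONGEST}$ model. The network is an undirected simple graph $G=(V,E)$ with $n$ vertices and arbitrary nonnegative real edge weights; the vertices carry pairwise distinct identifiers, and each vertex numbers its incident edges in an arbitrary way (ports). Initially a vertex knows its own identifier, the weights of its incident edges, and a number $N$, the same for all vertices, that approximates $n$ within a fixed constant factor $a$ (i.e. $n/a\le N\le a\,n$). All vertices run the same deterministic algorithm, which may depend on $a$ and on the constant $c$ below. In each synchronous round every vertex sends one message of $O(\log n)$ bits (at most a constant times $\lfloor\log_2 n\rfloor+1$) through each of its ports; local computation is free. After the last round every vertex selects some of its incident edges, and the algorithm constructs the subgraph $H\subseteq G$ of all edges selected by at least one endpoint. $H$ is a $3$-spanner of $G$ if $\mathrm{dist}(u,v,H)\le 3\,\mathrm{dist}(u,v,G)$ for all $u,v\in V$, where $\mathrm{dist}$ denotes weighted distance ($\infty$ between vertices in different components). Theorem (3-spanners for weighted graphs). Let $a,c$ be constants; all constants in the $O$-notation of the conclusions depend only on $a$ and $c$. (1) There is a deterministic $\mathsf{CONGEST}$ algorithm that, on every weighted $n$-vertex graph whose identifiers have at most $c\,(\lfloor\log_2 n\rfloor+1)$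 bits, constructs a $3$-spanner with $O(n^{3/2})$ edges in $O(\log n)$ rounds (the bound on the number of rounds is asserted for $n\ge 2$), and both endpoints of every edge know whether it is in the spanner. (2) There is a deterministic $\mathsf{CONGEST}$ algorithm that, on every weighted $n$-vertex graph whose identifiers lie in $[1,c\,n]$, constructs a $3$-spanner with $O(n^{3/2})$ edges in two rounds. If, in addition, every vertex initially knows the identifiers of its neighbors, there is such an algorithm with two rounds after which both endpoints of every edge know whether it is in the spanner. -/

import Mathlib

open scoped NNReal ENNReal

universe u

/-- The distance between `u` and `v` in the graph `H` with edge weights `w`: the least total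
weight of a walk of `H` from `u` to `v`, and `∞` if there is none. -/
noncomputable def wdist {V : Type*} (H : SimpleGraph V) (w : Sym2 V → ℝ≥0) (u v : V) : ℝ≥0∞ :=
  ⨅ p : H.Walk u v, (((p.edges.map w).sum : ℝ≥0) : ℝ≥0∞)

/-- `H` is a `k`-spanner of the weighted graph `(G, w)`. -/
def IsSpanner {V : Type*} (G : SimpleGraph V) (w : Sym2 V → ℝ≥0) (k : ℕ) (H : SimpleGraph V) :
    Prop :=
  H ≤ G ∧ ∀ u v : V, wdist H w u v ≤ (k : ℝ≥0∞) * wdist G w u v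

/-- A weighted communication network: a graph with nonnegative real edge weights (the values of
`weight` off the edge set play no role), pairwise distinct identifiers of the vertices, and at each
vertex an arbitrary numbering of the incident edges by ports `0, …, deg v - 1`. -/
structure Network (V : Type*) where
  graph : SimpleGraph V
  weight : Sym2 V → ℝ≥0
  ident : V → ℕ
  ident_injective : Function.Injective ident
  deg : V → ℕ
  port : ∀ v : V, Fin (deg v) ≃ graph.neighborSet v

namespace Network

variable {V : Type*} (M : Network V)

/-- The neighbor of `v` at the other end of port `i`. -/
def nbr (v : V) (i : Fin (M.deg v)) : V :=
  (M.port v i : V)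

theorem adj_nbr (v : V) (i : Fin (M.deg v)) : M.graph.Adj v (M.nbr v i) :=
  (M.port v i).2

/-- The port that the edge at port `i` of `v` has at its other endpoint. -/
def backPort (v : V) (i : Fin (M.deg v)) : Fin (M.deg (M.nbr v i)) :=
  (M.port (M.nbr v i)).symm ⟨v, (M.adj_nbr v i).symm⟩

end Network

/-- What a vertex knows about its neighbors before the first round: nothing, or their
identifiers. -/
inductive InitialKnowledge where
  | portsOnly
  | neighborIdents

/-- A deterministic synchronous message passing algorithm. Every vertex runs the same (arbitrary)
local functions; messages are bit strings. -/
structure DistAlgorithm where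
  /-- The set of local states. -/
  State : Type
  /-- The first state, from the common estimate of the number of vertices, the own identifier, and
  for each port the weight of the edge and, if it is initially known, the identifier of the
  neighbor. -/
  init : ℕ → ℕ → List (ℝ≥0 × Option ℕ) → State
  /-- The message that is sent through each port. -/
  send : State → ℕ → List Bool
  /-- The new state, from the old one and the list of the messages received, ordered by port. -/
  receive : State → List (List Bool) → State
  /-- The number of rounds, as a function of the estimate of the number of vertices. -/
  rounds : ℕ → ℕ
  /-- The decision whether the edge at a port is selected, made after the last round. -/
  select : State → ℕ → Bool

namespace DistAlgorithm

variable {V : Type*} (A : DistAlgorithm) (κ : InitialKnowledge) (M : Network V) (N : ℕ)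

/-- What `v` initially knows of the identifier of its neighbor at port `i`. -/
def nbrInfo (v : V) (i : Fin (M.deg v)) : Option ℕ :=
  match κ with
  | .portsOnly => none
  | .neighborIdents => some (M.ident (M.nbr v i))

/-- The state of each vertex after `t` rounds, where `N` is the common estimate of the number of
vertices. -/
def state : ℕ → V → A.State
  | 0, v =>
      A.init N (M.ident v)
        (List.ofFn fun i : Fin (M.deg v) => (M.weight s(v, M.nbr v i), nbrInfo κ M v i))
  | t + 1, v =>
      A.receive (state t v)
        (List.ofFn fun i : Fin (M.deg v) => A.send (state t (M.nbr v i)) (M.backPort v i))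

/-- Every message sent during the execution has at most `B` bits. -/
def MessagesAtMost (B : ℕ) : Prop :=
  ∀ t < A.rounds N, ∀ (v : V) (i : Fin (M.deg v)),
    (A.send (A.state κ M N t v) i).length ≤ B

/-- Whether `v` selects its edge at port `i` when the algorithm ends. -/
def selects (v : V) (i : Fin (M.deg v)) : Bool :=
  A.select (A.state κ M N (A.rounds N) v) i

/-- The graph formed by the edges that at least one of their endpoints selects. -/
def output : SimpleGraph V where
  Adj u v :=
    (∃ i, M.nbr u i = v ∧ A.selects κ M N u i = true) ∨
      ∃ j, M.nbr v j = u ∧ A.selects κ M N v j = true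
  symm := ⟨fun _ _ h => h.symm⟩
  loopless := ⟨by
    rintro v (⟨i, hi, -⟩ | ⟨i, hi, -⟩) <;> exact (M.adj_nbr v i).ne hi.symm⟩

/-- Both endpoints of each edge make the same decision about it. -/
def EndpointsAgree : Prop :=
  ∀ (v : V) (i : Fin (M.deg v)),
    A.selects κ M N v i = A.selects κ M N (M.nbr v i) (M.backPort v i)

/-- On the network `M` with `n` vertices, the algorithm constructs a `3`-spanner with at most
`C * n ^ (3 / 2)` edges and sends only messages of at most `C * (⌊log₂ n⌋ + 1)` bits. -/
def ConstructsSparse3Spanner [Fintype V] (C : ℕ) : Prop :=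
  A.MessagesAtMost κ M N (C * Nat.size (Fintype.card V)) ∧
  IsSpanner M.graph M.weight 3 (A.output κ M N) ∧
  ((A.output κ M N).edgeSet.ncard : ℝ) ≤ C * (Fintype.card V : ℝ) ^ (3 / 2 : ℝ)

end DistAlgorithm

/-- `N` approximates `n` up to the factor `a`. -/
def ApproximatesWithin (a n N : ℕ) : Prop :=
  n ≤ a * N ∧ N ≤ a * n

/-!
All three algorithms make the same selection. Let the vertices be divided into `O(√n)` blocks of
size `O(√n)`. For every block, a vertex `v` selects a lightest edge to a neighbor `x` in the block,
and it names this *witness* `x` to all its neighbors in the block. In turn, a vertex `u` selects,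
for every vertex that was named to it, a lightest edge to a neighbor that named it. As only vertices
in the block of `u` are named to `u`, every vertex selects `O(√n)` edges. If `v` named `x` to `u`,
and `u` selected the edge to `v'` for `x`, then `u, v', x, v` is a walk of selected edges none of
which is heavier than the edge from `u` to `v` (`isSpanner_blockSelect`). This takes one round to tell
blocks and identifiers, one round to name the witnesses, and one round to tell the decisions to the
other endpoints. Vertices of degree less than the threshold `s = √N + 1` may select all their
edges, so it suffices that the blocks of the other vertices are small (`card_blockSelect_le`).

If the identifiers are of size `O(n)`, then intervals of identifiers serve as blocks.

If the identifiers have `O(log n)` bits, blocks are computed first. Start with all vertices of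
degree at least `s` as roots; for each bit position in turn, roots with bit `1` give way to roots
with bit `0` at distance at most `2`. In the end the roots have disjoint neighborhoods of size at
least `s`, so there are at most `n / s` of them (`Ruling.card_mul_le`), while all vertices of large
degree are at distance `O(log n)` from a root. Hence breadth-first trees of depth `O(log n)` around
the roots cover these vertices. Each tree is numbered in preorder, from the sizes of the subtrees,
and `s` consecutive numbers of a tree form a block. Each tree leaves at most one incomplete block,
so there are `O(√n)` blocks (`IsNumbering.card_blocks_le`).

Algorithms are given as lists of rounds with natural numbers as messages, and are verified by Hoare
triples (`Network.Runs`) that also bound the lengths of the messages.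
-/

/-! ### Programs: lists of rounds whose messages are natural numbers -/

/-- One communication round of vertices with local state `S`; a message is a natural number. -/
structure Round (S : Type) where
  /-- The message sent through each port. -/
  send : S → ℕ → ℕ
  /-- The new state, from the old one and the messages received, ordered by port. -/
  recv : S → List ℕ → S

namespace Network

variable {V : Type*} (M : Network V)

@[simp]
theorem nbr_backPort (v : V) (i : Fin (M.deg v)) : M.nbr (M.nbr v i) (M.backPort v i) = v := by
  change ((M.port _ ((M.port _).symm _) : M.graph.neighborSet _) : V) = v
  rw [Equiv.apply_symm_apply]

theorem nbr_injective (v : V) : Function.Injective (M.nbr v) :=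
  Subtype.val_injective.comp (M.port v).injective

theorem nbr_congr {v w : V} {i : Fin (M.deg v)} {j : Fin (M.deg w)} (h : v = w)
    (hij : (i : ℕ) = j) : M.nbr v i = M.nbr w j := by
  subst h
  rw [Fin.ext hij]

theorem exists_port {u v : V} (h : M.graph.Adj u v) : ∃ i, M.nbr u i = v :=
  ⟨(M.port u).symm ⟨v, h⟩, by simp [nbr]⟩

/-- Stated for the port numbers as naturals, since the two ports have different dependent types. -/
theorem backPort_val {u v : V} (i : Fin (M.deg u)) (j : Fin (M.deg v)) (hi : M.nbr u i = v)
    (hj : M.nbr v j = u) : (M.backPort u i : ℕ) = j := by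
  subst hi
  congr 1
  apply M.nbr_injective
  rw [nbr_backPort, hj]

@[simp]
theorem backPort_backPort (v : V) (i : Fin (M.deg v)) :
    (M.backPort (M.nbr v i) (M.backPort v i) : ℕ) = i :=
  M.backPort_val _ _ (M.nbr_backPort v i) rfl

/-- The global effect of a round on the states of all vertices. -/
def step {S : Type} (r : Round S) (σ : V → S) (v : V) : S :=
  r.recv (σ v) (List.ofFn fun i : Fin (M.deg v) => r.send (σ (M.nbr v i)) (M.backPort v i))

/-- The global effect of a list of rounds. -/
def exec {S : Type} : List (Round S) → (V → S) → V → S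
  | [], σ => σ
  | r :: p, σ => exec p (M.step r σ)

/-- All messages sent while the program runs from `σ` have at most `B` binary digits. -/
def Fits {S : Type} (B : ℕ) : List (Round S) → (V → S) → Prop
  | [], _ => True
  | r :: p, σ =>
    (∀ (v : V) (i : Fin (M.deg v)), Nat.size (r.send (σ v) i) ≤ B) ∧ Fits B p (M.step r σ)

/-- The Hoare triple for programs with messages of at most `B` bits. -/
def Runs {S : Type} (B : ℕ) (P : (V → S) → Prop) (p : List (Round S)) (Q : (V → S) → Prop) :
    Prop :=
  ∀ σ, P σ → M.Fits B p σ ∧ Q (M.exec p σ)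

variable {M} {S : Type} {B : ℕ} {P Q R : (V → S) → Prop} {p q : List (Round S)}

theorem exec_append (σ : V → S) : M.exec (p ++ q) σ = M.exec q (M.exec p σ) := by
  induction p generalizing σ with
  | nil => rfl
  | cons r p ih => exact ih _

theorem fits_append (σ : V → S) :
    M.Fits B (p ++ q) σ ↔ M.Fits B p σ ∧ M.Fits B q (M.exec p σ) := by
  induction p generalizing σ with
  | nil => simp [Fits, exec]
  | cons r p ih => simp [Fits, exec, ih, and_assoc]

theorem Runs.append (h₁ : M.Runs B P p Q) (h₂ : M.Runs B Q q R) : M.Runs B P (p ++ q) R := by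
  intro σ hσ
  rw [fits_append, exec_append]
  exact ⟨⟨(h₁ σ hσ).1, (h₂ _ (h₁ σ hσ).2).1⟩, (h₂ _ (h₁ σ hσ).2).2⟩

theorem Runs.weaken (h : M.Runs B P p Q) {P' Q' : (V → S) → Prop} (hP : ∀ σ, P' σ → P σ)
    (hQ : ∀ σ, Q σ → Q' σ) : M.Runs B P' p Q' :=
  fun σ hσ => ⟨(h σ (hP σ hσ)).1, hQ _ (h σ (hP σ hσ)).2⟩

theorem Fits.mono {B' : ℕ} (hB : B ≤ B') {σ : V → S} (h : M.Fits B p σ) : M.Fits B' p σ := by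
  induction p generalizing σ with
  | nil => trivial
  | cons r p ih => exact ⟨fun v i => (h.1 v i).trans hB, ih h.2⟩

theorem Runs.mono_bits {B' : ℕ} (h : M.Runs B P p Q) (hB : B ≤ B') : M.Runs B' P p Q :=
  fun σ hσ => ⟨(h σ hσ).1.mono hB, (h σ hσ).2⟩

theorem runs_single {r : Round S}
    (h : ∀ σ, P σ → (∀ (v : V) (i : Fin (M.deg v)), Nat.size (r.send (σ v) i) ≤ B) ∧
      Q (M.step r σ)) : M.Runs B P [r] Q :=
  fun σ hσ => ⟨⟨(h σ hσ).1, trivial⟩, (h σ hσ).2⟩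

/-- The invariant rule for loops. -/
theorem runs_loop {I : ℕ → (V → S) → Prop} {f : ℕ → List (Round S)} (k : ℕ)
    (h : ∀ j < k, M.Runs B (I j) (f j) (I (j + 1))) :
    M.Runs B (I 0) ((List.range k).flatMap f) (I k) := by
  induction k with
  | zero => exact fun σ hσ => ⟨trivial, hσ⟩
  | succ k ih =>
    rw [List.range_succ, List.flatMap_append]
    refine (ih fun j hj => h j (by omega)).append ?_
    simpa using h k (by omega)

theorem Fits.size_send {r : Round S} {σ : V → S} (h : M.Fits B (p ++ r :: q) σ) (v : V)
    (i : Fin (M.deg v)) : Nat.size (r.send (M.exec p σ v) i) ≤ B :=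
  ((fits_append σ).1 h).2.1 v i

end Network

theorem nat_bits_injective : Function.Injective Nat.bits := by
  intro m n h
  induction m using Nat.binaryRec' generalizing n with
  | zero =>
    induction n using Nat.binaryRec' with
    | zero => rfl
    | bit b n hn _ => rw [Nat.bits_append_bit n b hn] at h; simp at h
  | bit a m hm ih =>
    rw [Nat.bits_append_bit m a hm] at h
    induction n using Nat.binaryRec' with
    | zero => simp at h
    | bit b n hn _ =>
      rw [Nat.bits_append_bit n b hn] at h
      obtain ⟨rfl, h'⟩ := List.cons.inj h
      rw [ih h']

/-- The distributed algorithm that runs the program `prog N`: a state also holds the rounds that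
are still to come, and a message is sent as its list of binary digits. -/
noncomputable def Round.toAlgorithm {S : Type} (prog : ℕ → List (Round S))
    (init : ℕ → ℕ → List (ℝ≥0 × Option ℕ) → S) (select : S → ℕ → Bool) : DistAlgorithm where
  State := List (Round S) × S
  init N x l := (prog N, init N x l)
  send
    | ([], _), _ => []
    | (r :: _, s), i => Nat.bits (r.send s i)
  receive
    | ([], s), _ => ([], s)
    | (r :: p, s), l => (p, r.recv s (l.map (Function.invFun Nat.bits)))
  rounds N := (prog N).length
  select s i := select s.2 i

namespace Round

variable {V : Type*} {S : Type} (prog : ℕ → List (Round S))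
  (init : ℕ → ℕ → List (ℝ≥0 × Option ℕ) → S) (select : S → ℕ → Bool)
  (κ : InitialKnowledge) (M : Network V) (N : ℕ)

/-- The states of all vertices before the first round. -/
def start (v : V) : S :=
  init N (M.ident v) (List.ofFn fun i : Fin (M.deg v) =>
    (M.weight s(v, M.nbr v i), DistAlgorithm.nbrInfo κ M v i))

theorem toAlgorithm_state {p q : List (Round S)} (h : prog N = p ++ q) (v : V) :
    (toAlgorithm prog init select).state κ M N p.length v
      = (q, M.exec p (start init κ M N) v) := by
  induction p using List.reverseRecOn generalizing q v with
  | nil => simp only [List.nil_append] at h; subst h; rfl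
  | append_singleton p r ih =>
    have ih' := @ih (r :: q) (by rw [h]; simp)
    rw [List.length_append, List.length_singleton, DistAlgorithm.state, ih', Network.exec_append]
    simp only [ih']
    have inv : ∀ x, Function.invFun Nat.bits (Nat.bits x) = x :=
      Function.leftInverse_invFun nat_bits_injective
    simp [toAlgorithm, Network.exec, Network.step, List.map_ofFn, Function.comp_def, inv]

theorem toAlgorithm_selects (v : V) (i : Fin (M.deg v)) :
    (toAlgorithm prog init select).selects κ M N v i
      = select (M.exec (prog N) (start init κ M N) v) i := by
  have h := toAlgorithm_state prog init select κ M N (p := prog N) (q := []) (by simp) v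
  unfold DistAlgorithm.selects
  change (toAlgorithm prog init select).select
    ((toAlgorithm prog init select).state κ M N (prog N).length v) i = _
  rw [h]
  rfl

theorem toAlgorithm_messagesAtMost {B : ℕ} (h : M.Fits B (prog N) (start init κ M N)) :
    (toAlgorithm prog init select).MessagesAtMost κ M N B := by
  intro t ht v i
  change t < (prog N).length at ht
  have hs : prog N = (prog N).take t ++ (prog N)[t] :: (prog N).drop (t + 1) := by simp
  have hlen : ((prog N).take t).length = t := by simp; omega
  have key := toAlgorithm_state prog init select κ M N hs v
  rw [hlen] at key
  rw [key]
  rw [hs] at h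
  change (Nat.bits _).length ≤ B
  rw [Nat.size_eq_bits_len]
  exact h.size_send v i

end Round

/-! ### Spanners from lightest edges in classes -/

/-- It suffices to check the stretch of a spanner on the edges. -/
theorem isSpanner_of_adj {V : Type*} {G H : SimpleGraph V} {w : Sym2 V → ℝ≥0} {k : ℕ} (hk : k ≠ 0)
    (hle : H ≤ G)
    (h : ∀ u v, G.Adj u v → ∃ q : H.Walk u v, (q.edges.map w).sum ≤ k * w s(u, v)) :
    IsSpanner G w k H := by
  refine ⟨hle, fun u v => ?_⟩
  have key : ∀ {u v : V} (p : G.Walk u v),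
      ∃ q : H.Walk u v, (q.edges.map w).sum ≤ k * (p.edges.map w).sum := by
    intro u v p
    induction p with
    | nil => exact ⟨.nil, by simp⟩
    | cons hadj p ih =>
      obtain ⟨q₁, h₁⟩ := h _ _ hadj
      obtain ⟨q₂, h₂⟩ := ih
      refine ⟨q₁.append q₂, ?_⟩
      simpa [SimpleGraph.Walk.edges_append, mul_add] using add_le_add h₁ h₂
  unfold wdist
  rw [ENNReal.mul_iInf_of_ne (by exact_mod_cast hk) (by simp)]
  refine le_iInf fun p => ?_
  obtain ⟨q, hq⟩ := key p
  exact (iInf_le _ q).trans (by exact_mod_cast hq)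

/-- Port `i` has the least weight among the ports of class `k`, where `ws` and `cls` list the
weights and the classes of all ports. -/
def IsLightest (ws : List ℝ≥0) (cls : List ℕ) (k i : ℕ) : Prop :=
  i < ws.length ∧ cls.getD i 0 = k ∧ ∀ j < ws.length, cls.getD j 0 = k → ws.getD i 0 ≤ ws.getD j 0

/-- One lightest port of class `k`, the same one whenever the same lists are given; a junk value if
the class is empty. -/
noncomputable def lightest (ws : List ℝ≥0) (cls : List ℕ) (k : ℕ) : ℕ :=
  Classical.epsilon (IsLightest ws cls k)

theorem isLightest_lightest {ws : List ℝ≥0} {cls : List ℕ} {k i : ℕ} (hi : i < ws.length)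
    (hk : cls.getD i 0 = k) : IsLightest ws cls k (lightest ws cls k) := by
  obtain ⟨j, hj, hmin⟩ := Finset.exists_min_image
    ((Finset.range ws.length).filter fun j => cls.getD j 0 = k) (fun j => ws.getD j 0)
    ⟨i, by simp only [Finset.mem_filter, Finset.mem_range]; exact ⟨hi, hk⟩⟩
  simp only [Finset.mem_filter, Finset.mem_range, and_imp] at hj hmin
  exact Classical.epsilon_spec ⟨j, hj.1, hj.2, hmin⟩

theorem getD_ofFn {α : Type*} {d : ℕ} (f : Fin d → α) (a : α) (i : Fin d) :
    (List.ofFn f).getD i a = f i := by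
  simp [List.getD]

theorem card_lightest_le {d : ℕ} (ws : List ℝ≥0) (cls : List ℕ) (T : Finset ℕ)
    (hT : ∀ i : Fin d, cls.getD i 0 ∈ T) :
    (Finset.univ.filter fun i : Fin d => lightest ws cls (cls.getD i 0) = i).card ≤ T.card := by
  refine Finset.card_le_card_of_injOn (fun i => cls.getD i 0) (fun i _ => hT i) ?_
  intro i hi j hj hij
  simp only [Finset.coe_filter, Finset.mem_univ, true_and, Set.mem_ofPred_eq] at hi hj hij
  rw [hij, hj] at hi
  exact Fin.ext hi.symm

/-- The decision of a vertex about its port `i`, where `s` is the degree threshold, `ws`, `blk`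
list the weights of the edges and the blocks of the neighbors, and `nms` lists the identifiers
that the neighbors named. -/
def LocalSelect (s : ℕ) (ws : List ℝ≥0) (blk nms : List ℕ) (i : ℕ) : Prop :=
  ws.length < s ∨ lightest ws blk (blk.getD i 0) = i ∨ lightest ws nms (nms.getD i 0) = i

namespace Network

variable {V : Type*} (M : Network V)

/-- The graph of the edges that are selected at one of their endpoints. -/
def selGraph (sel : ∀ v, Fin (M.deg v) → Prop) : SimpleGraph V where
  Adj u v := (∃ i, M.nbr u i = v ∧ sel u i) ∨ ∃ j, M.nbr v j = u ∧ sel v j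
  symm := ⟨fun _ _ h => h.symm⟩
  loopless := ⟨by
    rintro v (⟨i, hi, -⟩ | ⟨i, hi, -⟩) <;> exact (M.adj_nbr v i).ne hi.symm⟩

theorem selGraph_le (sel : ∀ v, Fin (M.deg v) → Prop) : M.selGraph sel ≤ M.graph := by
  rintro u v (⟨i, rfl, -⟩ | ⟨i, rfl, -⟩)
  · exact M.adj_nbr u i
  · exact (M.adj_nbr v i).symm

/-- Making a selection known to the other endpoints does not change the graph. -/
theorem selGraph_symmetrize (sel : V → ℕ → Prop) :
    M.selGraph (fun v i => sel v i ∨ sel (M.nbr v i) (M.backPort v i))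
      = M.selGraph fun v i => sel v i := by
  ext u v
  constructor
  · rintro (⟨i, rfl, h | h⟩ | ⟨i, rfl, h | h⟩)
    · exact Or.inl ⟨i, rfl, h⟩
    · exact Or.inr ⟨_, M.nbr_backPort u i, h⟩
    · exact Or.inr ⟨i, rfl, h⟩
    · exact Or.inl ⟨_, M.nbr_backPort v i, h⟩
  · rintro (⟨i, rfl, h⟩ | ⟨i, rfl, h⟩)
    · exact Or.inl ⟨i, rfl, Or.inl h⟩
    · exact Or.inr ⟨i, rfl, Or.inl h⟩

theorem ncard_selGraph_le [Fintype V] (sel : ∀ v, Fin (M.deg v) → Prop)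
    [∀ v, DecidablePred (sel v)] (b : ℕ)
    (hb : ∀ v, (Finset.univ.filter (sel v)).card ≤ b) :
    (M.selGraph sel).edgeSet.ncard ≤ Fintype.card V * b := by
  classical
  let F : Finset (Σ v, Fin (M.deg v)) := Finset.univ.sigma fun v => Finset.univ.filter (sel v)
  have hsub : (M.selGraph sel).edgeSet ⊆
      (F.image fun x : Σ v, Fin (M.deg v) => s(x.1, M.nbr x.1 x.2) : Finset (Sym2 V)) := by
    intro e
    induction e using Sym2.ind with
    | _ u v =>
    intro he
    change (M.selGraph sel).Adj u v at he
    rcases he with ⟨i, rfl, h⟩ | ⟨i, rfl, h⟩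
    · simp only [Finset.coe_image, Set.mem_image]
      exact ⟨⟨u, i⟩, by simp [F, h], rfl⟩
    · simp only [Finset.coe_image, Set.mem_image]
      exact ⟨⟨v, i⟩, by simp [F, h], Sym2.eq_swap⟩
  calc (M.selGraph sel).edgeSet.ncard
      ≤ (F.image fun x : Σ v, Fin (M.deg v) => s(x.1, M.nbr x.1 x.2)).card := by
        rw [← Set.ncard_coe_finset]
        exact Set.ncard_le_ncard hsub
    _ ≤ F.card := Finset.card_image_le
    _ = ∑ v, (Finset.univ.filter (sel v)).card := Finset.card_sigma _ _
    _ ≤ ∑ _v : V, b := Finset.sum_le_sum fun v _ => hb v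
    _ = Fintype.card V * b := by simp

/-- The weights of the edges at `v`, listed by port. -/
def portWeights (v : V) : List ℝ≥0 :=
  List.ofFn fun i : Fin (M.deg v) => M.weight s(v, M.nbr v i)

/-- The values of `f` at the neighbors of `v`, listed by port. -/
def nbrValues (f : V → ℕ) (v : V) : List ℕ :=
  List.ofFn fun i : Fin (M.deg v) => f (M.nbr v i)

/-- The identifier of the neighbor across the chosen lightest edge from `v` to the block `k`; a junk
value if `v` has no neighbor in this block. -/
noncomputable def witness (β : V → ℕ) (v : V) (k : ℕ) : ℕ :=
  (M.nbrValues M.ident v).getD (lightest (M.portWeights v) (M.nbrValues β v) k) 0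

/-- The identifiers that the neighbors of `u` name to `u`, listed by port: each neighbor names the
witness for the block of `u`. -/
noncomputable def names (β : V → ℕ) (u : V) : List ℕ :=
  List.ofFn fun i : Fin (M.deg u) => M.witness β (M.nbr u i) (β u)

/-- The selection made with the blocks `β` and the degree threshold `s`. -/
def BlockSelect (s : ℕ) (β : V → ℕ) (v : V) (i : ℕ) : Prop :=
  LocalSelect s (M.portWeights v) (M.nbrValues β v) (M.names β v) i

@[simp]
theorem length_portWeights (v : V) : (M.portWeights v).length = M.deg v := by simp [portWeights]

/-- The witness of `v` for a block that has neighbors of `v` is a neighbor in that block, its edge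
is as light as any edge from `v` to the block, and `v` selects this edge. -/
theorem exists_witness (s : ℕ) (β : V → ℕ) (v : V) (i : Fin (M.deg v)) :
    ∃ j : Fin (M.deg v), M.witness β v (β (M.nbr v i)) = M.ident (M.nbr v j) ∧
      β (M.nbr v j) = β (M.nbr v i) ∧
      M.weight s(v, M.nbr v j) ≤ M.weight s(v, M.nbr v i) ∧ M.BlockSelect s β v j := by
  obtain ⟨h₁, h₂, h₃⟩ := isLightest_lightest (ws := M.portWeights v) (cls := M.nbrValues β v)
    (k := β (M.nbr v i)) (i := i) (by simp) (getD_ofFn _ _ i)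
  set j := lightest (M.portWeights v) (M.nbrValues β v) (β (M.nbr v i)) with hj
  rw [length_portWeights] at h₁
  have h₂' : β (M.nbr v ⟨j, h₁⟩) = β (M.nbr v i) := by
    rw [← h₂]; exact (getD_ofFn (fun i => β (M.nbr v i)) 0 ⟨j, h₁⟩).symm
  refine ⟨⟨j, h₁⟩, getD_ofFn _ _ (⟨j, h₁⟩ : Fin (M.deg v)), h₂', ?_, ?_⟩
  · have := h₃ i (by simp) (getD_ofFn _ _ i)
    rwa [portWeights, getD_ofFn _ _ i, getD_ofFn _ _ (⟨j, h₁⟩ : Fin (M.deg v))] at this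
  · exact Or.inr (Or.inl (by rw [h₂]))

/-- If `v` did not select its edge to `u`, then it named to `u` some `x`, and `u` selects an edge
to some `v'` that named `x` as well; the detour `u, v', x, v` has three edges that are no heavier
than the edge from `u` to `v`. -/
theorem isSpanner_blockSelect (s : ℕ) (β : V → ℕ) :
    IsSpanner M.graph M.weight 3 (M.selGraph fun v i => M.BlockSelect s β v i) := by
  refine isSpanner_of_adj (by norm_num) (M.selGraph_le _) fun u v huv => ?_
  set H := M.selGraph fun v i => M.BlockSelect s β v i with hH
  have adj : ∀ (v : V) (i : Fin (M.deg v)), M.BlockSelect s β v i → H.Adj v (M.nbr v i) :=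
    fun v i h => Or.inl ⟨i, rfl, h⟩
  obtain ⟨i, hi⟩ := M.exists_port huv.symm
  obtain ⟨j, hj⟩ := M.exists_port huv
  obtain ⟨x, hx₁, -, hx₃, hx₄⟩ := M.exists_witness s β v i
  obtain ⟨h₁, h₂, h₃⟩ := isLightest_lightest (ws := M.portWeights u) (cls := M.names β u)
    (k := (M.names β u).getD j 0) (i := j) (by simp) rfl
  set l := lightest (M.portWeights u) (M.names β u) ((M.names β u).getD j 0) with hl
  rw [length_portWeights] at h₁
  have hsel : M.BlockSelect s β u (⟨l, h₁⟩ : Fin (M.deg u)) :=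
    Or.inr (Or.inr (by rw [h₂]))
  have hw := h₃ j (by simp) rfl
  rw [portWeights, getD_ofFn _ _ j, getD_ofFn _ _ (⟨l, h₁⟩ : Fin (M.deg u)), hj] at hw
  rw [names, getD_ofFn _ _ j, getD_ofFn _ _ (⟨l, h₁⟩ : Fin (M.deg u)), hj] at h₂
  set v' := M.nbr u ⟨l, h₁⟩ with hv'
  obtain ⟨i', hi'⟩ := M.exists_port (M.adj_nbr u ⟨l, h₁⟩).symm
  obtain ⟨x', hx₁', -, hx₃', hx₄'⟩ := M.exists_witness s β v' i'
  rw [hi'] at hx₁' hx₃'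
  rw [hi] at hx₁ hx₃
  have hxx : M.nbr v' x' = M.nbr v x := M.ident_injective (by rw [← hx₁', ← hx₁, h₂])
  have a₁ : H.Adj u v' := adj u _ hsel
  have a₂ : H.Adj v' (M.nbr v x) := hxx ▸ adj v' x' hx₄'
  have a₃ : H.Adj (M.nbr v x) v := (adj v x hx₄).symm
  refine ⟨.cons a₁ (.cons a₂ (.cons a₃ .nil)), ?_⟩
  rw [hxx] at hx₃'
  have e₁ : M.weight s(v', M.nbr v x) ≤ M.weight s(u, v) :=
    hx₃'.trans (by rw [Sym2.eq_swap]; exact hw)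
  have e₂ : M.weight s(M.nbr v x, v) ≤ M.weight s(u, v) := by
    rw [Sym2.eq_swap, Sym2.eq_swap (a := u)]; exact hx₃
  simp only [SimpleGraph.Walk.edges_cons, SimpleGraph.Walk.edges_nil, List.map_cons, List.map_nil,
    List.sum_cons, List.sum_nil, add_zero]
  calc _ ≤ M.weight s(u, v) + (M.weight s(u, v) + M.weight s(u, v)) :=
        add_le_add hw (add_le_add e₁ e₂)
    _ = _ := by push_cast; ring

/-- A vertex selects at most one edge for each block and at most one for each vertex in its own
block, unless its degree is below the threshold. -/
theorem card_blockSelect_le [Fintype V] [DecidableEq V] (s q : ℕ) (β : V → ℕ)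
    (hq : (Finset.univ.image β).card ≤ q)
    (hs : ∀ v, s ≤ M.deg v → (Finset.univ.filter fun x => β x = β v).card ≤ s) (v : V)
    [DecidablePred fun i : Fin (M.deg v) => M.BlockSelect s β v i] :
    (Finset.univ.filter fun i : Fin (M.deg v) => M.BlockSelect s β v i).card ≤ q + s := by
  by_cases hv : M.deg v < s
  · exact (Finset.card_le_univ _).trans (by simp; omega)
  have hblk := card_lightest_le (d := M.deg v) (M.portWeights v) (M.nbrValues β v)
    (Finset.univ.image β) fun i => by
      rw [nbrValues, getD_ofFn]; exact Finset.mem_image_of_mem _ (Finset.mem_univ _)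
  have hnm := card_lightest_le (d := M.deg v) (M.portWeights v) (M.names β v)
    ((Finset.univ.filter fun x => β x = β v).image M.ident) fun i => by
      rw [names, getD_ofFn]
      have h := M.exists_witness s β (M.nbr v i) (M.backPort v i)
      rw [nbr_backPort] at h
      obtain ⟨j, hj, hβ, -⟩ := h
      rw [hj]
      exact Finset.mem_image_of_mem _ (by simpa using hβ)
  refine (Finset.card_le_card (t := (Finset.univ.filter fun i : Fin (M.deg v) =>
      lightest (M.portWeights v) (M.nbrValues β v) ((M.nbrValues β v).getD i 0) = i) ∪
    Finset.univ.filter fun i : Fin (M.deg v) =>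
      lightest (M.portWeights v) (M.names β v) ((M.names β v).getD i 0) = i) ?_).trans ?_
  · intro i hi
    simp only [Finset.mem_filter, Finset.mem_univ, true_and, Finset.mem_union] at hi ⊢
    rcases hi with h | h
    · rw [length_portWeights] at h; exact absurd h hv
    · exact h
  · exact (Finset.card_union_le _ _).trans (add_le_add (hblk.trans hq)
      (hnm.trans (Finset.card_image_le.trans (hs v (not_lt.1 hv)))))

end Network

/-! ### The three rounds that select a spanner -/

/-- The local state of a vertex. Lists are indexed by the ports. -/
structure Node where
  /-- The degree threshold, which is also the bound on the sizes of the blocks. -/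
  thr : ℕ
  ident : ℕ
  weights : List ℝ≥0
  /-- `0`, or `x + 1` where `x` is the identifier of the root of the tree of the vertex. -/
  lead : ℕ
  /-- Whether the vertex or one of its neighbors is a root that announced itself. -/
  flag : Bool
  /-- The port to the parent in the tree. -/
  par : Option ℕ
  /-- The sizes of the subtrees at the children, and `0` at ports that lead to no child. -/
  kids : List ℕ
  /-- The position in the preorder numbering of the tree. -/
  off : ℕ
  /-- The name of the block of the vertex. -/
  label : ℕ
  /-- The blocks of the neighbors. -/
  nlab : List ℕ
  /-- The identifiers of the neighbors. -/
  nid : List ℕ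
  /-- The identifiers that the neighbors named. -/
  names : List ℕ
  /-- The decisions of the neighbors about the common edges. -/
  other : List ℕ

namespace Node

/-- The first state. The initial block is an interval of identifiers, and the initial roots are the
vertices of degree at least the threshold. The lists `nlab` and `nid` hold the blocks and
identifiers of the neighbors if those are initially known, and junk values otherwise. -/
def init (N x : ℕ) (l : List (ℝ≥0 × Option ℕ)) : Node where
  thr := Nat.sqrt N + 1
  ident := x
  weights := l.map Prod.fst
  lead := if Nat.sqrt N + 1 ≤ l.length then x + 1 else 0
  flag := false
  par := none
  kids := []
  off := 0
  label := x / (Nat.sqrt N + 1)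
  nlab := l.map fun p => p.2.getD 0 / (Nat.sqrt N + 1)
  nid := l.map fun p => p.2.getD 0
  names := []
  other := []

/-- Every vertex tells its block and its identifier to its neighbors. -/
def introduce : Round Node where
  send x _ := Nat.pair x.label x.ident
  recv x l := { x with nlab := l.map fun m => m.unpair.1, nid := l.map fun m => m.unpair.2 }

/-- Every vertex names to each neighbor `u` its witness for the block of `u`. -/
noncomputable def nominate : Round Node where
  send x i := x.nid.getD (lightest x.weights x.nlab (x.nlab.getD i 0)) 0
  recv x l := { x with names := l }

open Classical in
/-- Every vertex tells its decisions to its neighbors. -/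
noncomputable def announce : Round Node where
  send x i := if LocalSelect x.thr x.weights x.nlab x.names i then 1 else 0
  recv x l := { x with other := l }

open Classical in
/-- The final decision: an edge is selected if the vertex chose it, or learned that the neighbor
did. -/
noncomputable def decide (x : Node) (i : ℕ) : Bool :=
  Decidable.decide (LocalSelect x.thr x.weights x.nlab x.names i ∨ x.other.getD i 0 = 1)

end Node

namespace Network

variable {V : Type*} (M : Network V)

/-- The local input is stored, and nothing was learned about the decisions of neighbors. -/
def Static (s : ℕ) (σ : V → Node) : Prop :=
  ∀ v, (σ v).thr = s ∧ (σ v).ident = M.ident v ∧ (σ v).weights = M.portWeights v ∧ (σ v).other = []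

/-- All vertices know their blocks. -/
def Labelled (s : ℕ) (β : V → ℕ) (σ : V → Node) : Prop :=
  M.Static s σ ∧ ∀ v, (σ v).label = β v

/-- All vertices know the blocks and the identifiers of their neighbors. -/
def Introduced (s : ℕ) (β : V → ℕ) (σ : V → Node) : Prop :=
  M.Static s σ ∧ ∀ v, (σ v).nlab = M.nbrValues β v ∧ (σ v).nid = M.nbrValues M.ident v

/-- All vertices can make the selection with the blocks `β`. -/
def Nominated (s : ℕ) (β : V → ℕ) (σ : V → Node) : Prop :=
  (∀ v, (σ v).other = []) ∧
    ∀ v i, LocalSelect (σ v).thr (σ v).weights (σ v).nlab (σ v).names i ↔ M.BlockSelect s β v i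

variable {M} {s B : ℕ} {β : V → ℕ}

theorem runs_introduce (hB : ∀ v, Nat.size (Nat.pair (β v) (M.ident v)) ≤ B) :
    M.Runs B (M.Labelled s β) [Node.introduce] (M.Introduced s β) := by
  refine runs_single fun σ ⟨h₁, h₂⟩ => ⟨fun v i => ?_, fun v => ?_, fun v => ?_⟩
  · simpa [Node.introduce, h₂, (h₁ v).2.1] using hB v
  · simpa [step, Node.introduce] using h₁ v
  · have hid : ∀ v, (σ v).ident = M.ident v := fun v => (h₁ v).2.1
    simp [step, Node.introduce, h₂, hid, List.map_ofFn, Function.comp_def, nbrValues]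

theorem runs_nominate (hB : ∀ v, Nat.size (M.ident v) ≤ B) :
    M.Runs B (M.Introduced s β) [Node.nominate] (M.Nominated s β) := by
  refine runs_single fun σ ⟨h₁, h₂⟩ => ?_
  have hsend : ∀ v (i : Fin (M.deg v)),
      Node.nominate.send (σ v) i = M.witness β v (β (M.nbr v i)) := by
    intro v i
    simp only [Node.nominate, (h₁ v).2.2.1, (h₂ v).1, (h₂ v).2, witness]
    congr 2
    exact getD_ofFn _ _ i
  refine ⟨fun v i => ?_, fun v => (h₁ v).2.2.2, fun v i => ?_⟩
  · obtain ⟨j, hj, -⟩ := M.exists_witness s β v i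
    rw [hsend, hj]
    exact hB _
  · simp only [step, hsend, nbr_backPort]
    simp only [Node.nominate, BlockSelect, names, (h₁ v).1, (h₁ v).2.2.1, (h₂ v).1]

theorem runs_announce (hB : V → 1 ≤ B) :
    M.Runs B (M.Nominated s β) [Node.announce] fun σ => ∀ (v : V) (i : Fin (M.deg v)),
      (σ v).decide i = true ↔
        (M.BlockSelect s β v i ∨ M.BlockSelect s β (M.nbr v i) (M.backPort v i)) := by
  classical
  refine runs_single fun σ ⟨h₁, h₂⟩ => ⟨fun v i => ?_, fun v i => ?_⟩
  · refine (Nat.size_le_size (n := 1) ?_).trans (by simpa using hB v)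
    simp only [Node.announce]
    split_ifs <;> omega
  · simp only [Node.decide, decide_eq_true_eq]
    have h : (M.step Node.announce σ v).other.getD i 0 = 1 ↔
        M.BlockSelect s β (M.nbr v i) (M.backPort v i) := by
      change (List.ofFn _).getD i 0 = 1 ↔ _
      rw [getD_ofFn, ← h₂]
      simp [Node.announce]
    rw [h]
    exact or_congr_left (h₂ v i)

theorem Nominated.decide_iff {σ : V → Node} (h : M.Nominated s β σ) (v : V) (i : ℕ) :
    (σ v).decide i = true ↔ M.BlockSelect s β v i := by
  simp [Node.decide, h.1, h.2]

theorem selGraph_decide_of_nominated {s : ℕ} {β : V → ℕ} {σ : V → Node}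
    (h : M.Nominated s β σ) :
    M.selGraph (fun v i => (σ v).decide i = true) =
      M.selGraph fun v i => M.BlockSelect s β v i := by
  simp only [h.decide_iff]

theorem selGraph_decide_of_announced {s : ℕ} {β : V → ℕ} {σ : V → Node}
    (h : ∀ (v : V) (i : Fin (M.deg v)), (σ v).decide i = true ↔
      (M.BlockSelect s β v i ∨ M.BlockSelect s β (M.nbr v i) (M.backPort v i))) :
    M.selGraph (fun v i => (σ v).decide i = true) =
      M.selGraph fun v i => M.BlockSelect s β v i := by
  simp only [h]
  exact M.selGraph_symmetrize _

end Network

/-- The algorithm with states `Node` that runs the program `prog N`. -/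
noncomputable def Node.algorithm (prog : ℕ → List (Round Node)) : DistAlgorithm :=
  Round.toAlgorithm prog Node.init Node.decide

namespace Network

variable {V : Type*} {M : Network V} {κ : InitialKnowledge} {prog : ℕ → List (Round Node)}
  {N B : ℕ} {β : V → ℕ} {P : (V → Node) → Prop}

theorem static_start : M.Static (Nat.sqrt N + 1) (Round.start Node.init κ M N) := by
  intro v
  simp [Round.start, Node.init, portWeights, List.map_ofFn, Function.comp_def]

theorem labelled_start : M.Labelled (Nat.sqrt N + 1) (fun v => M.ident v / (Nat.sqrt N + 1))
    (Round.start Node.init κ M N) :=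
  ⟨static_start, fun _ => rfl⟩

theorem introduced_start :
    M.Introduced (Nat.sqrt N + 1) (fun v => M.ident v / (Nat.sqrt N + 1))
      (Round.start Node.init .neighborIdents M N) := by
  refine ⟨static_start, fun v => ?_⟩
  simp [Round.start, Node.init, nbrValues, List.map_ofFn, Function.comp_def,
    DistAlgorithm.nbrInfo]

/-- A program that ends with the selection by blocks constructs a sparse spanner if there are few
blocks, and the blocks of vertices of large degree are small. -/
theorem constructsSparse3Spanner [Fintype V] [DecidableEq V] {q s C : ℕ}
    (hP : P (Round.start Node.init κ M N))
    (hrun : M.Runs B P (prog N) fun σ =>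
      M.selGraph (fun v i => (σ v).decide i = true) = M.selGraph fun v i => M.BlockSelect s β v i)
    (hB : B ≤ C * Nat.size (Fintype.card V))
    (hq : (Finset.univ.image β).card ≤ q)
    (hs : ∀ v, s ≤ M.deg v → (Finset.univ.filter fun x => β x = β v).card ≤ s)
    (hC : ((q + s : ℕ) : ℝ) ≤ C * √(Fintype.card V)) :
    (Node.algorithm prog).ConstructsSparse3Spanner κ M N C := by
  classical
  obtain ⟨hfits, hsel⟩ := hrun _ hP
  have hout : (Node.algorithm prog).output κ M N = M.selGraph fun v i => M.BlockSelect s β v i := by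
    rw [← hsel]
    change M.selGraph (fun v i => (Node.algorithm prog).selects κ M N v i = true) = _
    simp only [Node.algorithm, Round.toAlgorithm_selects]
  refine ⟨fun t ht v i => ?_, ?_, ?_⟩
  · exact (Round.toAlgorithm_messagesAtMost _ _ _ _ _ _ hfits t ht v i).trans hB
  · rw [hout]
    exact M.isSpanner_blockSelect s β
  · rw [hout]
    have h := M.ncard_selGraph_le (fun v (i : Fin (M.deg v)) => M.BlockSelect s β v i) (q + s)
      fun v => M.card_blockSelect_le s q β hq hs v
    set n := Fintype.card V
    have hn : ((n : ℝ)) ^ (3 / 2 : ℝ) = n * √n := by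
      rcases Nat.eq_zero_or_pos n with h0 | h0
      · rw [h0]; norm_num
      · rw [Real.sqrt_eq_rpow, ← Real.rpow_one_add' (by positivity) (by norm_num)]
        norm_num
    calc ((M.selGraph fun v i => M.BlockSelect s β v i).edgeSet.ncard : ℝ)
        ≤ (n * (q + s) : ℕ) := by exact_mod_cast h
      _ = n * ((q + s : ℕ) : ℝ) := by push_cast; ring
      _ ≤ n * (C * √n) := by gcongr
      _ = C * (n : ℝ) ^ (3 / 2 : ℝ) := by rw [hn]; ring

theorem endpointsAgree {s : ℕ} (hP : P (Round.start Node.init κ M N))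
    (hrun : M.Runs B P (prog N) fun σ => ∀ (v : V) (i : Fin (M.deg v)),
      (σ v).decide i = true ↔
        (M.BlockSelect s β v i ∨ M.BlockSelect s β (M.nbr v i) (M.backPort v i))) :
    (Node.algorithm prog).EndpointsAgree κ M N := by
  obtain ⟨-, h⟩ := hrun _ hP
  intro v i
  rw [Bool.eq_iff_iff]
  simp only [Node.algorithm, Round.toAlgorithm_selects]
  rw [h, h, backPort_backPort, nbr_backPort, or_comm]

end Network

/-! ### Estimates for the threshold `√N + 1` -/

/-- Together with `div_threshold_le`: both the block size `√N + 1` and the number of such blocks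
that `n` vertices fill are `O(√n)`. -/
theorem threshold_le {a n N : ℕ} (h : ApproximatesWithin a n N) (hn : 0 < n) :
    ((Nat.sqrt N + 1 : ℕ) : ℝ) ≤ (a + 1) * √n := by
  have h1 : (1 : ℝ) ≤ √n := by rw [Real.one_le_sqrt]; exact_mod_cast hn
  have h2 : (Nat.sqrt N : ℝ) ≤ a * √n := by
    have e : (a : ℝ) * √n = √(a ^ 2 * n) := by
      rw [Real.sqrt_mul (by positivity), Real.sqrt_sq (by positivity)]
    rw [e]
    apply Real.le_sqrt_of_sq_le
    have : Nat.sqrt N ^ 2 ≤ a ^ 2 * n := by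
      have := h.2
      have h4 := Nat.sqrt_le' N
      nlinarith [Nat.le_self_pow (two_ne_zero) a]
    exact_mod_cast this
  push_cast
  nlinarith

theorem div_threshold_le {a n N : ℕ} (h : ApproximatesWithin a n N) :
    ((n / (Nat.sqrt N + 1) : ℕ) : ℝ) ≤ a * √n := by
  refine Nat.cast_div_le.trans ?_
  rw [div_le_iff₀ (by positivity)]
  have h1 : √(n : ℝ) ≤ a * (Nat.sqrt N + 1 : ℕ) := by
    rw [Real.sqrt_le_left (by positivity)]
    have : n ≤ (a * (Nat.sqrt N + 1)) ^ 2 := by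
      have h3 := Nat.lt_succ_sqrt' N
      have := h.1
      rw [mul_pow]
      have h5 : a ≤ a ^ 2 := Nat.le_self_pow two_ne_zero a
      calc n ≤ a * N := this
        _ ≤ a ^ 2 * (Nat.sqrt N + 1) ^ 2 := Nat.mul_le_mul h5 h3.le
    exact_mod_cast this
  calc (n : ℝ) = √n * √n := (Real.mul_self_sqrt (by positivity)).symm
    _ ≤ √n * (a * (Nat.sqrt N + 1 : ℕ)) := by gcongr
    _ = _ := by ring

theorem size_pair_le {x y k : ℕ} (hx : Nat.size x ≤ k) (hy : Nat.size y ≤ k) :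
    Nat.size (Nat.pair x y) ≤ 2 * k := by
  rw [Nat.size_le] at *
  refine (Nat.pair_lt_max_add_one_sq x y).trans_le ?_
  rw [mul_comm, pow_mul]
  gcongr
  exact max_lt hx hy

theorem size_mul_le (x y : ℕ) : Nat.size (x * y) ≤ Nat.size x + Nat.size y := by
  rw [Nat.size_le, pow_add]
  exact Nat.mul_lt_mul'' (Nat.lt_size_self x) (Nat.lt_size_self y)

theorem constructsSparse3Spanner_of_isEmpty {V : Type*} [Fintype V] [IsEmpty V]
    {A : DistAlgorithm} {κ : InitialKnowledge} {M : Network V} {N C : ℕ} :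
    A.ConstructsSparse3Spanner κ M N C := by
  have he : ∀ G : SimpleGraph V, G.edgeSet = ∅ := fun G => by
    ext e
    induction e using Sym2.ind with
    | _ u v => exact isEmptyElim u
  exact ⟨fun t _ v => isEmptyElim v, ⟨fun u => isEmptyElim u, fun u => isEmptyElim u⟩,
    by rw [he]; simp⟩

/-! ### Identifiers of linear size -/

section LinearIdentifiers

variable {V : Type*} [Fintype V] {M : Network V} {a c N : ℕ}

theorem card_interval_blocks_le [DecidableEq V] (s : ℕ)
    (hid : ∀ v, M.ident v ≤ c * Fintype.card V) :
    (Finset.univ.image fun v => M.ident v / s).card ≤ c * (Fintype.card V / s + 1) + 1 := by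
  refine (Finset.card_le_card (t := Finset.range (c * (Fintype.card V / s + 1) + 1)) ?_).trans
    (by simp)
  intro k hk
  obtain ⟨v, -, rfl⟩ := Finset.mem_image.1 hk
  rw [Finset.mem_range, Nat.lt_succ_iff]
  rcases Nat.eq_zero_or_pos s with rfl | hs
  · simp
  refine Nat.div_le_of_le_mul ((hid v).trans ?_)
  calc c * Fintype.card V ≤ c * (s * (Fintype.card V / s + 1)) :=
        Nat.mul_le_mul_left _ (Nat.lt_mul_div_succ _ hs).le
    _ = _ := by ring

theorem card_interval_block_le [DecidableEq V] {s : ℕ} (hs : 0 < s) (k : ℕ) :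
    (Finset.univ.filter fun x => M.ident x / s = k).card ≤ s := by
  rw [← Finset.card_image_of_injective _ M.ident_injective]
  refine (Finset.card_le_card (t := Finset.Ico (k * s) (k * s + s)) ?_).trans (by simp)
  intro y hy
  obtain ⟨x, hx, rfl⟩ := Finset.mem_image.1 hy
  simp only [Finset.mem_filter, Finset.mem_univ, true_and] at hx
  rw [Finset.mem_Ico, ← hx]
  refine ⟨Nat.div_mul_le_self _ _, ?_⟩
  have := Nat.lt_mul_div_succ (M.ident x) hs
  rwa [Nat.mul_succ, mul_comm] at this

theorem interval_block_estimate (h : ApproximatesWithin a (Fintype.card V) N)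
    (hn : 0 < Fintype.card V) :
    ((c * (Fintype.card V / (Nat.sqrt N + 1) + 1) + 1 + (Nat.sqrt N + 1) : ℕ) : ℝ)
      ≤ (c * a + c + a + 2 : ℕ) * √(Fintype.card V) := by
  have h1 := threshold_le h hn
  have h2 := div_threshold_le h
  have h3 : (1 : ℝ) ≤ √(Fintype.card V) := by rw [Real.one_le_sqrt]; exact_mod_cast hn
  have h4 := mul_le_mul_of_nonneg_left h2 (Nat.cast_nonneg (α := ℝ) c)
  have h5 := mul_le_mul_of_nonneg_left h3 (Nat.cast_nonneg (α := ℝ) c)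
  push_cast at h1 h2 h4 ⊢
  nlinarith

theorem interval_blocks_constructsSparse3Spanner {κ : InitialKnowledge} {C B : ℕ}
    {P : (V → Node) → Prop} {prog : ℕ → List (Round Node)}
    (h : ApproximatesWithin a (Fintype.card V) N)
    (hid : ∀ v, M.ident v ≤ c * Fintype.card V)
    (hP : P (Round.start Node.init κ M N))
    (hrun : M.Runs B P (prog N) fun σ =>
      M.selGraph (fun v i => (σ v).decide i = true) = M.selGraph fun v i =>
        M.BlockSelect (Nat.sqrt N + 1) (fun v => M.ident v / (Nat.sqrt N + 1)) v i)
    (hB : B ≤ C * Nat.size (Fintype.card V)) (hC : c * a + c + a + 2 ≤ C) :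
    (Node.algorithm prog).ConstructsSparse3Spanner κ M N C := by
  classical
  rcases Nat.eq_zero_or_pos (Fintype.card V) with hn | hn
  · have : IsEmpty V := Fintype.card_eq_zero_iff.1 hn
    exact constructsSparse3Spanner_of_isEmpty
  · exact Network.constructsSparse3Spanner hP hrun hB (card_interval_blocks_le _ hid)
      (fun v _ => card_interval_block_le (Nat.succ_pos _) _)
      ((interval_block_estimate h hn).trans (by gcongr))

theorem size_ident_le_of_le_mul (hid : ∀ v, M.ident v ≤ c * Fintype.card V) (v : V) :
    Nat.size (M.ident v) ≤ (Nat.size c + 1) * Nat.size (Fintype.card V) := by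
  have hn : 0 < Nat.size (Fintype.card V) := Nat.size_pos.2 (Fintype.card_pos_iff.2 ⟨v⟩)
  have := (Nat.size_le_size (hid v)).trans (size_mul_le _ _)
  nlinarith [Nat.zero_le (Nat.size c)]

end LinearIdentifiers

/-- The blocks are intervals of identifiers, so that the neighbors' identifiers, which the first
round tells, determine their blocks. -/
theorem exists_algorithm_portsOnly (a c : ℕ) :
    ∃ (A : DistAlgorithm) (C : ℕ), (∀ N, A.rounds N = 2) ∧
      ∀ (V : Type u) [Fintype V] (M : Network V) (N : ℕ),
        ApproximatesWithin a (Fintype.card V) N →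
        (∀ v, 1 ≤ M.ident v ∧ M.ident v ≤ c * Fintype.card V) →
          A.ConstructsSparse3Spanner .portsOnly M N C := by
  refine ⟨Node.algorithm fun _ => [Node.introduce] ++ [Node.nominate],
    2 * (Nat.size c + 1) + (c * a + c + a + 2), fun _ => rfl, ?_⟩
  intro V _ M N hN hid
  have hsz := size_ident_le_of_le_mul fun v => (hid v).2
  refine interval_blocks_constructsSparse3Spanner
    (B := 2 * ((Nat.size c + 1) * Nat.size (Fintype.card V))) hN
    (fun v => (hid v).2) Network.labelled_start
    (((Network.runs_introduce fun v => ?_).append (Network.runs_nominate fun v => ?_)).weaken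
      (fun _ => id) fun σ => Network.selGraph_decide_of_nominated) ?_ (by omega)
  · exact size_pair_le ((Nat.size_le_size (Nat.div_le_self _ _)).trans (hsz v)) (hsz v)
  · exact (hsz v).trans (by omega)
  · rw [← mul_assoc]
    gcongr
    omega

/-- Neighbors' blocks are known from the start, so that the second round is free for telling the
decisions. -/
theorem exists_algorithm_neighborIdents (a c : ℕ) :
    ∃ (A : DistAlgorithm) (C : ℕ), (∀ N, A.rounds N = 2) ∧
      ∀ (V : Type u) [Fintype V] (M : Network V) (N : ℕ),
        ApproximatesWithin a (Fintype.card V) N →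
        (∀ v, 1 ≤ M.ident v ∧ M.ident v ≤ c * Fintype.card V) →
          A.ConstructsSparse3Spanner .neighborIdents M N C ∧
          A.EndpointsAgree .neighborIdents M N := by
  refine ⟨Node.algorithm fun _ => [Node.nominate] ++ [Node.announce],
    (Nat.size c + 1) + (c * a + c + a + 2), fun _ => rfl, ?_⟩
  intro V _ M N hN hid
  have hsz := size_ident_le_of_le_mul fun v => (hid v).2
  have hrun := (Network.runs_nominate (s := Nat.sqrt N + 1)
      (β := fun v => M.ident v / (Nat.sqrt N + 1)) hsz).append
    (Network.runs_announce fun v => by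
      have : 0 < Nat.size (Fintype.card V) := Nat.size_pos.2 (Fintype.card_pos_iff.2 ⟨v⟩)
      exact Nat.mul_pos (Nat.succ_pos _) this)
  refine ⟨interval_blocks_constructsSparse3Spanner hN (fun v => (hid v).2)
    Network.introduced_start
    (hrun.weaken (fun _ => id) fun σ => Network.selGraph_decide_of_announced)
    (Nat.mul_le_mul_right _ (by omega)) (by omega), ?_⟩
  exact Network.endpointsAgree Network.introduced_start hrun

/-! ### Roots: a ruling set of the vertices of large degree -/

namespace Node

/-- Roots whose identifier has bit `0` at position `b` announce themselves. -/
def spread (b : ℕ) : Round Node where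
  send x _ := if x.lead ≠ 0 ∧ x.ident.testBit b = false then 1 else 0
  recv x l := { x with
    flag := Decidable.decide ((x.lead ≠ 0 ∧ x.ident.testBit b = false) ∨ ∃ m ∈ l, m ≠ 0) }

/-- Roots whose identifier has bit `1` at position `b` give way to announced roots at distance at
most `2`. -/
def giveWay (b : ℕ) : Round Node where
  send x _ := if x.flag then 1 else 0
  recv x l := { x with
    lead := if x.ident.testBit b ∧ (x.flag ∨ ∃ m ∈ l, m ≠ 0) then 0 else x.lead }

/-- All positions of the bits of identifiers are treated in turn. -/
def ruling (K : ℕ) : List (Round Node) :=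
  (List.range K).flatMap fun b => [spread b] ++ [giveWay b]

end Node

namespace Network

variable {V : Type*} (M : Network V)

/-- `v` lies in the closed neighborhood of `u`. -/
def Close (u v : V) : Prop :=
  u = v ∨ M.graph.Adj u v

variable {M}

theorem Close.symm {u v : V} (h : M.Close u v) : M.Close v u :=
  h.imp Eq.symm fun h => h.symm

theorem Close.exists_walk {u v : V} (h : M.Close u v) : ∃ p : M.graph.Walk u v, p.length ≤ 1 := by
  rcases h with rfl | h
  · exact ⟨.nil, by simp⟩
  · exact ⟨.cons h .nil, by simp⟩

theorem exists_mem_ofFn_iff {P : V → Prop} (v : V) (f : Fin (M.deg v) → ℕ)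
    (hf : ∀ i, f i ≠ 0 ↔ P (M.nbr v i)) :
    (∃ m ∈ List.ofFn f, m ≠ 0) ↔ ∃ u, M.graph.Adj v u ∧ P u := by
  constructor
  · rintro ⟨m, hm, h0⟩
    obtain ⟨i, rfl⟩ := (List.mem_ofFn' f m).1 hm
    exact ⟨_, M.adj_nbr v i, (hf i).1 h0⟩
  · rintro ⟨u, hu, h⟩
    obtain ⟨i, rfl⟩ := M.exists_port hu
    exact ⟨f i, (List.mem_ofFn' f _).2 ⟨i, rfl⟩, (hf i).2 h⟩

theorem close_and_iff {P : V → Prop} (v : V) :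
    (P v ∨ ∃ u, M.graph.Adj v u ∧ P u) ↔ ∃ u, M.Close v u ∧ P u := by
  constructor
  · rintro (h | ⟨u, hu, h⟩)
    · exact ⟨v, .inl rfl, h⟩
    · exact ⟨u, .inr hu, h⟩
  · rintro ⟨u, rfl | hu, h⟩
    · exact .inl h
    · exact .inr ⟨u, hu, h⟩

variable (M) in
/-- The invariant of the ruling set computation: roots have large degree, roots at distance at most
`2` agree in the first `b` bits of their identifiers, and every vertex of large degree is at
distance at most `2 * b` from a root. -/
structure Ruling (s b : ℕ) (σ : V → Node) : Prop where
  static : M.Static s σ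
  fresh : ∀ v, (σ v).par = none ∧ (σ v).kids = [] ∧ (σ v).off = 0
  lead_eq : ∀ v, (σ v).lead ≠ 0 → (σ v).lead = M.ident v + 1
  large : ∀ v, (σ v).lead ≠ 0 → s ≤ M.deg v
  agree : ∀ u v x, (σ u).lead ≠ 0 → (σ v).lead ≠ 0 → M.Close x u → M.Close x v →
    ∀ i < b, (M.ident u).testBit i = (M.ident v).testBit i
  near : ∀ v, s ≤ M.deg v → ∃ r, (σ r).lead ≠ 0 ∧ ∃ p : M.graph.Walk v r, p.length ≤ 2 * b

theorem ruling_start {κ : InitialKnowledge} {N : ℕ} :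
    M.Ruling (Nat.sqrt N + 1) 0 (Round.start Node.init κ M N) := by
  have hlead : ∀ v, (Round.start Node.init κ M N v).lead ≠ 0 ↔ Nat.sqrt N + 1 ≤ M.deg v := by
    intro v
    simp [Round.start, Node.init]
  refine ⟨static_start, fun v => ⟨rfl, rfl, rfl⟩, fun v hv => ?_, fun v => (hlead v).1, ?_,
    fun v hv => ⟨v, (hlead v).2 hv, .nil, by simp⟩⟩
  · simp only [Round.start, Node.init, ne_eq, ite_eq_right_iff, not_forall] at hv ⊢
    exact if_pos hv.1
  · intros
    omega

theorem runs_spread_giveWay {s B : ℕ} (hB : V → 1 ≤ B) (b : ℕ) :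
    M.Runs B (M.Ruling s b) ([Node.spread b] ++ [Node.giveWay b]) (M.Ruling s (b + 1)) := by
  classical
  have hsize : ∀ (v : V) (p : Prop) [Decidable p], Nat.size (if p then 1 else 0) ≤ B := by
    intro v p _
    refine (Nat.size_le_size (n := 1) ?_).trans (by simpa using hB v)
    split_ifs <;> omega
  refine Runs.append (Q := fun σ => M.Ruling s b σ ∧ ∀ x, (σ x).flag = true ↔
    ∃ u, M.Close x u ∧ ((σ u).lead ≠ 0 ∧ (M.ident u).testBit b = false))
    (runs_single fun σ h => ⟨fun v i => hsize v _, ?_⟩)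
    (runs_single fun σ ⟨h, hflag⟩ => ⟨fun v i => hsize v _, ?_⟩)
  · refine ⟨⟨h.static, h.fresh, h.lead_eq, h.large, h.agree, h.near⟩, fun x => ?_⟩
    have hid : ∀ v, (σ v).ident = M.ident v := fun v => (h.static v).2.1
    simp only [step, Node.spread, decide_eq_true_eq, hid]
    rw [exists_mem_ofFn_iff (P := fun u => (σ u).lead ≠ 0 ∧ (M.ident u).testBit b = false) x _
      fun i => by simp]
    exact close_and_iff (P := fun u => (σ u).lead ≠ 0 ∧ (M.ident u).testBit b = false) x
  · set τ := M.step (Node.giveWay b) σ with hτ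
    -- A vertex stops being a root exactly if it gives way to a root `u` with bit `0`.
    have hlead : ∀ v, (τ v).lead = if (M.ident v).testBit b = true ∧ ∃ x, M.Close v x ∧
        ∃ u, M.Close x u ∧ ((σ u).lead ≠ 0 ∧ (M.ident u).testBit b = false)
        then 0 else (σ v).lead := by
      intro v
      simp only [← hflag]
      rw [← close_and_iff (P := fun x => (σ x).flag = true) v, hτ]
      simp only [step, Node.giveWay, (h.static v).2.1]
      simp only [exists_mem_ofFn_iff (P := fun u => (σ u).flag = true) v
        (fun i => if (σ (M.nbr v i)).flag = true then 1 else 0) fun i => by simp]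
      congr
    have hle : ∀ v, (τ v).lead ≠ 0 → (τ v).lead = (σ v).lead ∧ (σ v).lead ≠ 0 := by
      intro v hv
      rw [hlead] at hv ⊢
      split_ifs at hv ⊢ with hc
      · exact absurd rfl hv
      · exact ⟨rfl, hv⟩
    have hkeep : ∀ v, (M.ident v).testBit b = false → (τ v).lead = (σ v).lead := by
      intro v hv
      rw [hlead, if_neg (by simp [hv])]
    -- Two remaining roots at distance at most `2` cannot differ at bit `b`.
    have hbit : ∀ u v x, (τ u).lead ≠ 0 → (τ v).lead ≠ 0 → M.Close x u → M.Close x v →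
        (M.ident u).testBit b = true → (M.ident v).testBit b = true := by
      intro u v x hu hv hxu hxv h1
      by_contra h0
      rw [Bool.not_eq_true] at h0
      exact hu ((hlead u).trans (if_pos ⟨h1, x, hxu.symm, v, hxv, (hle v hv).2, h0⟩))
    refine ⟨h.static, h.fresh, fun v hv => ?_, fun v hv => h.large v (hle v hv).2, ?_, ?_⟩
    · rw [(hle v hv).1]
      exact h.lead_eq v (hle v hv).2
    · intro u v x hu hv hxu hxv i hi
      rcases Nat.lt_succ_iff_lt_or_eq.1 hi with hi | rfl
      · exact h.agree u v x (hle u hu).2 (hle v hv).2 hxu hxv i hi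
      · rw [Bool.eq_iff_iff]
        exact ⟨hbit u v x hu hv hxu hxv, hbit v u x hv hu hxv hxu⟩
    · intro v hv
      obtain ⟨r, hr, p, hp⟩ := h.near v hv
      by_cases hr' : (τ r).lead = 0
      · rw [hlead] at hr'
        split_ifs at hr' with hc
        · obtain ⟨-, x, hx, u, hu, hu0, hub⟩ := hc
          obtain ⟨q₁, hq₁⟩ := hx.exists_walk
          obtain ⟨q₂, hq₂⟩ := hu.exists_walk
          refine ⟨u, by rwa [hkeep u hub], p.append (q₁.append q₂), ?_⟩
          simp only [SimpleGraph.Walk.length_append]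
          omega
        · exact absurd hr' hr
      · exact ⟨r, hr', p, by omega⟩

theorem runs_ruling {s B : ℕ} (hB : V → 1 ≤ B) (K : ℕ) :
    M.Runs B (M.Ruling s 0) (Node.ruling K) (M.Ruling s K) :=
  runs_loop K fun b _ => runs_spread_giveWay hB b

/-- Once all bits are treated, the closed neighborhoods of the roots are disjoint. -/
theorem Ruling.eq_of_close {s K : ℕ} {σ : V → Node} (h : M.Ruling s K σ)
    (hK : ∀ v, Nat.size (M.ident v) ≤ K) {u v x : V} (hu : (σ u).lead ≠ 0) (hv : (σ v).lead ≠ 0)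
    (hxu : M.Close x u) (hxv : M.Close x v) : u = v := by
  refine M.ident_injective (Nat.eq_of_testBit_eq fun i => ?_)
  rcases lt_or_ge i K with hi | hi
  · exact h.agree u v x hu hv hxu hxv i hi
  · have : ∀ w, (M.ident w).testBit i = false := fun w =>
      Nat.testBit_lt_two_pow ((Nat.size_le.1 (hK w)).trans_le
        (Nat.pow_le_pow_right two_pos hi))
    rw [this, this]

theorem Ruling.card_mul_le [Fintype V] {s K : ℕ} {σ : V → Node} (h : M.Ruling s K σ)
    (hK : ∀ v, Nat.size (M.ident v) ≤ K) :
    (Finset.univ.filter fun v => (σ v).lead ≠ 0).card * s ≤ Fintype.card V := by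
  classical
  have hdisj : ∀ u ∈ Finset.univ.filter (fun v => (σ v).lead ≠ 0),
      ∀ v ∈ Finset.univ.filter (fun v => (σ v).lead ≠ 0), u ≠ v →
      Disjoint (Finset.univ.image (M.nbr u)) (Finset.univ.image (M.nbr v)) := by
    intro u hu v hv huv
    rw [Finset.disjoint_left]
    intro x hxu hxv
    simp only [Finset.mem_image, Finset.mem_filter, Finset.mem_univ, true_and] at hu hv hxu hxv
    obtain ⟨i, rfl⟩ := hxu
    obtain ⟨j, hj⟩ := hxv
    exact huv (h.eq_of_close hK hu hv (.inr (M.adj_nbr u i).symm)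
      (.inr (hj ▸ (M.adj_nbr v j).symm)))
  calc _ = ∑ v ∈ Finset.univ.filter (fun v => (σ v).lead ≠ 0), s := by simp
    _ ≤ ∑ v ∈ Finset.univ.filter (fun v => (σ v).lead ≠ 0),
        (Finset.univ.image (M.nbr v)).card := by
      refine Finset.sum_le_sum fun v hv => ?_
      rw [Finset.card_image_of_injective _ (M.nbr_injective v), Finset.card_univ, Fintype.card_fin]
      exact h.large v (Finset.mem_filter.1 hv).2
    _ = _ := (Finset.card_biUnion hdisj).symm
    _ ≤ Fintype.card V := Finset.card_le_univ _

end Network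

/-! ### Trees: the vertices join the root that reaches them first -/

namespace Node

/-- A vertex that is in no tree joins the tree of a neighbor. -/
def grow : Round Node where
  send x _ := x.lead
  recv x l :=
    if x.lead = 0 ∧ l.findIdx (fun m => m ≠ 0) < l.length then
      { x with
        lead := l.getD (l.findIdx fun m => m ≠ 0) 0
        par := some (l.findIdx fun m => m ≠ 0) }
    else x

end Node

namespace Network

variable {V : Type*} (M : Network V)

/-- Port numbers `par` and levels `lvl` describe a forest whose trees carry distinct names `lead`;
the vertices in no tree have the name `0`. -/
structure IsForest (T : ℕ) (lead : V → ℕ) (par : V → Option ℕ) (lvl : V → ℕ) : Prop where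
  lvl_le : ∀ v, lvl v ≤ T
  parent : ∀ v k, par v = some k → ∃ i : Fin (M.deg v), (i : ℕ) = k ∧
    lead (M.nbr v i) = lead v ∧ lvl (M.nbr v i) < lvl v
  lead_ne : ∀ v, par v ≠ none → lead v ≠ 0
  root_inj : ∀ u v, par u = none → par v = none → lead u ≠ 0 → lead u = lead v → u = v
  lead_eq : ∀ v, lead v ≠ 0 → ∃ r, lead v = M.ident r + 1

/-- The invariant of the growth of the trees: after `T` rounds they have depth at most `T`, their
roots are the vertices in `R`, and they cover all vertices at distance at most `T` from `R`. -/
structure Grown (R : V → Prop) (s T : ℕ) (σ : V → Node) : Prop where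
  static : M.Static s σ
  fresh : ∀ v, (σ v).kids = [] ∧ (σ v).off = 0
  root : ∀ v, R v ↔ (σ v).lead ≠ 0 ∧ (σ v).par = none
  root_lead : ∀ v, R v → (σ v).lead = M.ident v + 1
  forest : ∃ lvl, M.IsForest T (fun v => (σ v).lead) (fun v => (σ v).par) lvl
  cover : ∀ v r, R r → (∃ p : M.graph.Walk v r, p.length ≤ T) → (σ v).lead ≠ 0

variable {M} {s B K : ℕ}

theorem Ruling.grown {σ : V → Node} (h : M.Ruling s K σ) :
    M.Grown (fun v => (σ v).lead ≠ 0) s 0 σ := by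
  refine ⟨h.static, fun v => (h.fresh v).2, fun v => ⟨fun hv => ⟨hv, (h.fresh v).1⟩, And.left⟩,
    h.lead_eq, ⟨fun _ => 0, fun _ => le_rfl, ?_, ?_, ?_, ?_⟩, ?_⟩
  · intro v k hk
    simp [(h.fresh v).1] at hk
  · intro v hv
    exact absurd (h.fresh v).1 hv
  · intro u v _ _ hu huv
    have hv : (σ v).lead ≠ 0 := fun h0 => hu (huv.trans h0)
    rw [h.lead_eq u hu, h.lead_eq v hv] at huv
    exact M.ident_injective (Nat.succ_injective huv)
  · exact fun v hv => ⟨v, h.lead_eq v hv⟩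
  · rintro v r hr ⟨p, hp⟩
    rwa [p.eq_of_length_eq_zero (by omega)]

theorem step_grow (σ : V → Node) (v : V) :
    (((σ v).lead ≠ 0 ∨ ∀ i, (σ (M.nbr v i)).lead = 0) ∧ M.step Node.grow σ v = σ v) ∨
    ((σ v).lead = 0 ∧ ∃ i : Fin (M.deg v), (σ (M.nbr v i)).lead ≠ 0 ∧
      M.step Node.grow σ v = { σ v with lead := (σ (M.nbr v i)).lead, par := some (i : ℕ) }) := by
  set l := List.ofFn fun i : Fin (M.deg v) => (σ (M.nbr v i)).lead with hl
  have hstep : M.step Node.grow σ v = Node.grow.recv (σ v) l := rfl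
  rw [hstep]
  simp only [Node.grow]
  split_ifs with h
  · right
    refine ⟨h.1, ?_⟩
    have hlen : l.length = M.deg v := by simp [hl]
    set k := l.findIdx fun m => m ≠ 0 with hk
    have hk' : k < M.deg v := hlen ▸ h.2
    have hget : l.getD k 0 = (σ (M.nbr v ⟨k, hk'⟩)).lead := getD_ofFn _ 0 (⟨k, hk'⟩ : Fin (M.deg v))
    refine ⟨⟨k, hk'⟩, ?_, by rw [hget]⟩
    rw [← hget]
    have := List.findIdx_getElem (xs := l) (p := fun m => m ≠ 0) (w := h.2)
    rw [List.getD_eq_getElem _ _ h.2]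
    exact of_decide_eq_true this
  · left
    refine ⟨?_, rfl⟩
    by_contra hc
    push Not at hc
    obtain ⟨h0, i, hi⟩ := hc
    exact h ⟨h0, List.findIdx_lt_length_of_exists
      ⟨_, (List.mem_ofFn' _ _).2 ⟨i, rfl⟩, by simpa using hi⟩⟩

theorem runs_grow {R : V → Prop} (hB : ∀ v, Nat.size (M.ident v + 1) ≤ B) (T : ℕ) :
    M.Runs B (M.Grown R s T) [Node.grow] (M.Grown R s (T + 1)) := by
  classical
  refine runs_single fun σ h => ⟨fun v i => ?_, ?_⟩
  · obtain ⟨lvl, hF⟩ := h.forest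
    change Nat.size (σ v).lead ≤ B
    by_cases h0 : (σ v).lead = 0
    · simp [h0]
    · obtain ⟨r, hr⟩ := hF.lead_eq v h0
      rw [hr]
      exact hB r
  set τ := M.step Node.grow σ with hτ
  have hkeep : ∀ v, (σ v).lead ≠ 0 → τ v = σ v := by
    intro v hv
    rcases step_grow (M := M) σ v with h' | h'
    · exact h'.2
    · exact absurd h'.1 hv
  have hother : ∀ v, (τ v).thr = (σ v).thr ∧ (τ v).ident = (σ v).ident ∧
      (τ v).weights = (σ v).weights ∧ (τ v).other = (σ v).other ∧ (τ v).kids = (σ v).kids ∧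
      (τ v).off = (σ v).off := by
    intro v
    rcases step_grow (M := M) σ v with ⟨-, h'⟩ | ⟨-, i, -, h'⟩ <;> simp [hτ, h']
  obtain ⟨lvl, hF⟩ := h.forest
  -- A vertex without a parent has not joined a tree in this round.
  have hnone : ∀ v, (τ v).par = none → τ v = σ v := by
    intro v hv
    rcases step_grow (M := M) σ v with ⟨-, h'⟩ | ⟨-, i, -, h'⟩
    · exact h'
    · simp [hτ, h'] at hv
  refine ⟨fun v => ?_, fun v => ?_, fun v => ?_, fun v hv => ?_,
    ⟨fun v => if (σ v).lead = 0 then T + 1 else lvl v, ?_, ?_, ?_, ?_, ?_⟩, ?_⟩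
  · obtain ⟨h1, h2, h3, h4, -⟩ := hother v
    rw [h1, h2, h3, h4]
    exact h.static v
  · obtain ⟨-, -, -, -, h5, h6⟩ := hother v
    rw [h5, h6]
    exact h.fresh v
  · rw [h.root]
    refine ⟨fun hv => by rwa [hkeep v hv.1], fun hv => ?_⟩
    rwa [hnone v hv.2] at hv
  · rw [hkeep v ((h.root v).1 hv).1]
    exact h.root_lead v hv
  · intro v
    have := hF.lvl_le v
    split_ifs <;> omega
  · intro v k hk
    rcases step_grow (M := M) σ v with ⟨-, h'⟩ | ⟨h0, i, hi, h'⟩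
    · rw [← hτ] at h'
      rw [h'] at hk ⊢
      obtain ⟨i, hik, hlead, hlvl⟩ := hF.parent v k hk
      have hv : (σ v).lead ≠ 0 := hF.lead_ne v (by rw [hk]; simp)
      have hi : (σ (M.nbr v i)).lead ≠ 0 := by rwa [hlead]
      refine ⟨i, hik, ?_, ?_⟩
      · rw [hkeep _ hi, hlead]
      · rwa [if_neg hi, if_neg hv]
    · rw [← hτ] at h'
      rw [h'] at hk ⊢
      refine ⟨i, Option.some_injective _ hk, ?_, ?_⟩
      · rw [hkeep _ hi]
      · rw [if_neg hi, if_pos h0]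
        exact Nat.lt_succ_of_le (hF.lvl_le _)
  · intro v hv
    rcases step_grow (M := M) σ v with ⟨-, h'⟩ | ⟨h0, i, hi, h'⟩
    · rw [← hτ] at h'
      rw [h'] at hv ⊢
      exact hF.lead_ne v hv
    · simpa [hτ, h'] using hi
  · intro u v hu hv
    have eu := hnone u hu
    have ev := hnone v hv
    rw [eu] at hu ⊢
    rw [ev] at hv ⊢
    exact hF.root_inj u v hu hv
  · intro v hv
    rcases step_grow (M := M) σ v with ⟨-, h'⟩ | ⟨h0, i, hi, h'⟩
    · rw [← hτ] at h'
      rw [h'] at hv ⊢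
      exact hF.lead_eq v hv
    · obtain ⟨r, hr⟩ := hF.lead_eq _ hi
      exact ⟨r, by simpa [hτ, h'] using hr⟩
  · rintro v r hr ⟨p, hp⟩
    by_cases hv : (σ v).lead = 0
    · cases p with
      | nil => exact absurd hv ((h.root v).1 hr).1
      | @cons _ w _ hvw p =>
        have hw := h.cover w r hr ⟨p, by simpa using hp⟩
        obtain ⟨i, rfl⟩ := M.exists_port hvw
        rcases step_grow (M := M) σ v with ⟨h' | h', -⟩ | ⟨h0, j, hj, h'⟩
        · exact absurd hv h'
        · exact absurd (h' i) hw
        · simpa [hτ, h'] using hj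
    · rwa [hkeep v hv]

theorem runs_grow_loop {R : V → Prop} (hB : ∀ v, Nat.size (M.ident v + 1) ≤ B) (T : ℕ) :
    M.Runs B (M.Grown R s 0) ((List.range T).flatMap fun _ => [Node.grow]) (M.Grown R s T) :=
  runs_loop T fun j _ => runs_grow hB j

end Network

/-! ### Preorder numbering of forests -/

namespace Network

variable {V : Type*} (M : Network V)

/-- The edge at port `i` of `v` leads to a child of `v`. -/
def IsChild (par : V → Option ℕ) (v : V) (i : Fin (M.deg v)) : Prop :=
  par (M.nbr v i) = some (M.backPort v i : ℕ)

open Classical in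
/-- The lists of the sizes of the subtrees at the children, cut off at depth `j`. -/
noncomputable def kidSizes (par : V → Option ℕ) : ℕ → V → List ℕ
  | 0, _ => []
  | j + 1, v => List.ofFn fun i : Fin (M.deg v) =>
      if M.IsChild par v i then 1 + (kidSizes par j (M.nbr v i)).sum else 0

/-- The preorder numbers that result from the list `K` of the sizes of subtrees, correct up to
depth `j`. -/
def preorder (par : V → Option ℕ) (K : V → List ℕ) : ℕ → V → ℕ
  | 0, _ => 0
  | j + 1, v => match par v with
    | none => 0
    | some k => (List.ofFn fun i : Fin (M.deg v) =>
        preorder par K j (M.nbr v i) + 1 + ((K (M.nbr v i)).take (M.backPort v i)).sum).getD k 0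

open Classical in
/-- `K` lists the sizes of the subtrees at the children, and `off` numbers each tree in preorder,
where children are ordered by port. -/
structure IsNumbering (par : V → Option ℕ) (K : V → List ℕ) (off : V → ℕ) : Prop where
  kids : ∀ v, K v = List.ofFn fun i : Fin (M.deg v) =>
    if M.IsChild par v i then 1 + (K (M.nbr v i)).sum else 0
  off_root : ∀ v, par v = none → off v = 0
  off_child : ∀ v (i : Fin (M.deg v)), par v = some (i : ℕ) →
    off v = off (M.nbr v i) + 1 + ((K (M.nbr v i)).take (M.backPort v i)).sum

/-- `p` is the parent of `u`. -/
def IsParent (par : V → Option ℕ) (p u : V) : Prop :=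
  ∃ i : Fin (M.deg u), par u = some (i : ℕ) ∧ M.nbr u i = p

variable {M} {T : ℕ} {lead : V → ℕ} {par : V → Option ℕ} {lvl : V → ℕ} {K : V → List ℕ}
  {off : V → ℕ}

theorem IsForest.lvl_child (hF : M.IsForest T lead par lvl) {v : V} {i : Fin (M.deg v)}
    (h : M.IsChild par v i) : lvl v < lvl (M.nbr v i) := by
  obtain ⟨j, hj, -, hl⟩ := hF.parent _ _ h
  rw [Fin.ext hj, nbr_backPort] at hl
  exact hl

theorem sum_kidSizes_mono (j : ℕ) (v : V) :
    (M.kidSizes par j v).sum ≤ (M.kidSizes par (j + 1) v).sum := by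
  induction j generalizing v with
  | zero => simp [kidSizes]
  | succ j ih =>
    rw [kidSizes, kidSizes, List.sum_ofFn, List.sum_ofFn]
    refine Finset.sum_le_sum fun i _ => ?_
    split_ifs
    · exact Nat.add_le_add_left (ih _) 1
    · exact le_rfl

theorem IsForest.kidSizes_stable (hF : M.IsForest T lead par lvl) (j : ℕ) (v : V)
    (h : T < j + lvl v) : M.kidSizes par j v = M.kidSizes par (j + 1) v := by
  induction j generalizing v with
  | zero => exact absurd (hF.lvl_le v) (by omega)
  | succ j ih =>
    rw [kidSizes, kidSizes]
    congr 1
    funext i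
    split_ifs with hc
    · rw [ih _ (by have := hF.lvl_child hc; omega)]
    · rfl

theorem IsForest.preorder_stable (hF : M.IsForest T lead par lvl) (j : ℕ) (v : V)
    (h : lvl v < j) : M.preorder par K j v = M.preorder par K (j + 1) v := by
  induction j generalizing v with
  | zero => omega
  | succ j ih =>
    rw [preorder, preorder]
    cases hp : par v with
    | none => rfl
    | some k =>
      obtain ⟨i, rfl, -, hl⟩ := hF.parent v k hp
      simp only [getD_ofFn _ _ i]
      rw [ih _ (by omega)]

theorem IsForest.isNumbering (hF : M.IsForest T lead par lvl) :
    M.IsNumbering par (M.kidSizes par (T + 1))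
      (M.preorder par (M.kidSizes par (T + 1)) (T + 1)) := by
  refine ⟨fun v => ?_, fun v hv => ?_, fun v i hv => ?_⟩
  · exact hF.kidSizes_stable (T + 1) v (by omega)
  · rw [preorder, hv]
  · have := hF.lvl_le v
    rw [hF.preorder_stable (T + 1) v (by omega), preorder, hv]
    exact getD_ofFn _ _ i

theorem IsForest.lvl_parent (hF : M.IsForest T lead par lvl) {p u : V}
    (h : M.IsParent par p u) : lvl p < lvl u ∧ lead p = lead u := by
  obtain ⟨i, hi, rfl⟩ := h
  obtain ⟨j, hj, h1, h2⟩ := hF.parent _ _ hi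
  rw [← Fin.ext hj]
  exact ⟨h2, h1⟩

theorem IsForest.exists_parent (hF : M.IsForest T lead par lvl) {u : V} (h : par u ≠ none) :
    ∃ p, M.IsParent par p u := by
  obtain ⟨k, hk⟩ := Option.ne_none_iff_exists'.1 h
  obtain ⟨i, rfl, -⟩ := hF.parent u k hk
  exact ⟨_, i, hk, rfl⟩

namespace IsNumbering

variable (hN : M.IsNumbering par K off)

include hN

/-- A child at port `i` takes the interval of numbers that follows those of its parent and of the
siblings at lower ports. -/
theorem child_interval {p u : V} (h : M.IsParent par p u) :
    ∃ i : Fin (M.deg p), M.nbr p i = u ∧ off u = off p + 1 + ((K p).take i).sum ∧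
      off u + (1 + (K u).sum) = off p + 1 + ((K p).take (i + 1)).sum := by
  obtain ⟨j, hj, rfl⟩ := h
  have hoff := hN.off_child u j hj
  refine ⟨M.backPort u j, M.nbr_backPort u j, hoff, ?_⟩
  have hlen : (M.backPort u j : ℕ) < (K (M.nbr u j)).length := by
    rw [hN.kids]
    simp
  have hget : (K (M.nbr u j))[(M.backPort u j : ℕ)] = 1 + (K u).sum := by
    have hc : M.IsChild par (M.nbr u j) (M.backPort u j) := by
      unfold IsChild
      rw [backPort_backPort, nbr_backPort, hj]
    rw [← List.getD_eq_getElem _ 0 hlen, hN.kids, getD_ofFn, if_pos hc, nbr_backPort]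
  rw [List.sum_take_succ _ _ hlen, hget, hoff]
  omega

theorem nested {p u : V} (h : M.IsParent par p u) :
    off p < off u ∧ off u + (1 + (K u).sum) ≤ off p + (1 + (K p).sum) := by
  obtain ⟨i, -, h1, h2⟩ := hN.child_interval h
  have h3 : ((K p).take (i + 1)).sum ≤ (K p).sum := (List.take_sublist _ _).sum_le_sum (by simp)
  omega

theorem disjoint_siblings {p u u' : V} (h : M.IsParent par p u) (h' : M.IsParent par p u')
    (hne : u ≠ u') : off u + (1 + (K u).sum) ≤ off u' ∨ off u' + (1 + (K u').sum) ≤ off u := by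
  obtain ⟨i, rfl, h1, h2⟩ := hN.child_interval h
  obtain ⟨i', rfl, h1', h2'⟩ := hN.child_interval h'
  have hmono := (K p).monotone_sum_take
  rcases lt_trichotomy (i : ℕ) i' with hi | hi | hi
  · left
    have := hmono (Nat.succ_le_of_lt hi)
    simp only [Nat.succ_eq_add_one] at this
    omega
  · exact absurd (congrArg (M.nbr p) (Fin.ext hi)) hne
  · right
    have := hmono (Nat.succ_le_of_lt hi)
    simp only [Nat.succ_eq_add_one] at this
    omega

theorem nested_of_reflTransGen {u v : V} (h : Relation.ReflTransGen (M.IsParent par) u v) :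
    off u ≤ off v ∧ off v + (1 + (K v).sum) ≤ off u + (1 + (K u).sum) := by
  induction h with
  | refl => exact ⟨le_rfl, le_rfl⟩
  | tail _ h ih =>
    have := hN.nested h
    omega

/-- In one tree, two vertices whose intervals meet are comparable. -/
theorem comparable (hF : M.IsForest T lead par lvl) {u v : V} (hlead : lead u = lead v)
    (h0 : lead u ≠ 0) {x : ℕ} (hu : off u ≤ x ∧ x < off u + (1 + (K u).sum))
    (hv : off v ≤ x ∧ x < off v + (1 + (K v).sum)) :
    Relation.ReflTransGen (M.IsParent par) u v ∨ Relation.ReflTransGen (M.IsParent par) v u := by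
  induction hm : lvl u + lvl v using Nat.strong_induction_on generalizing u v with
  | _ m ih =>
  -- Replacing a vertex that is not a root by its parent reduces the claim.
  have step : ∀ {u v : V}, lvl u + lvl v = m → lead u = lead v → lead u ≠ 0 →
      (off u ≤ x ∧ x < off u + (1 + (K u).sum)) → (off v ≤ x ∧ x < off v + (1 + (K v).sum)) →
      par u ≠ none →
      Relation.ReflTransGen (M.IsParent par) u v ∨
        Relation.ReflTransGen (M.IsParent par) v u := by
    intro u v hm hlead h0 hu hv hpu
    obtain ⟨p, hp⟩ := hF.exists_parent hpu
    obtain ⟨hl, hld⟩ := hF.lvl_parent hp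
    have hnest := hN.nested hp
    rcases ih (lvl p + lvl v) (by omega) (hld.trans hlead) (by rwa [hld])
      (by omega) hv rfl with h | h
    · rcases Relation.ReflTransGen.cases_head h with rfl | ⟨q, hq, hqv⟩
      · exact Or.inr (.single hp)
      · by_cases hqu : q = u
        · exact Or.inl (hqu ▸ hqv)
        · have h1 := hN.nested_of_reflTransGen hqv
          have h2 := hN.disjoint_siblings hp hq (Ne.symm hqu)
          omega
    · exact Or.inr (h.tail hp)
  by_cases hpu : par u = none
  · by_cases hpv : par v = none
    · rw [hF.root_inj u v hpu hpv h0 hlead]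
      exact Or.inl .refl
    · exact (step (by omega) hlead.symm (hlead ▸ h0) hv hu hpv).symm
  · exact step hm hlead h0 hu hv hpu

theorem off_injective (hF : M.IsForest T lead par lvl) {u v : V} (hlead : lead u = lead v)
    (h0 : lead u ≠ 0) (h : off u = off v) : u = v := by
  have key : ∀ {u v : V}, off u = off v → Relation.ReflTransGen (M.IsParent par) u v → u = v := by
    intro u v h huv
    rcases Relation.ReflTransGen.cases_head huv with rfl | ⟨q, hq, hqv⟩
    · rfl
    · have h1 := hN.nested hq
      have h2 := hN.nested_of_reflTransGen hqv
      omega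
  rcases hN.comparable hF hlead h0 (x := off u) (by omega) (by omega) with h' | h'
  · exact key h h'
  · exact (key h.symm h').symm

theorem exists_root (hF : M.IsForest T lead par lvl) (v : V) :
    ∃ r, par r = none ∧ lead r = lead v ∧ off v + (1 + (K v).sum) ≤ 1 + (K r).sum := by
  induction hm : lvl v using Nat.strong_induction_on generalizing v with
  | _ m ih =>
  by_cases hv : par v = none
  · exact ⟨v, hv, rfl, by rw [hN.off_root v hv]; omega⟩
  · obtain ⟨p, hp⟩ := hF.exists_parent hv
    obtain ⟨hl, hld⟩ := hF.lvl_parent hp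
    obtain ⟨r, hr, hrl, hro⟩ := ih (lvl p) (by omega) p rfl
    have := hN.nested hp
    exact ⟨r, hr, hrl.trans hld, by omega⟩

/-- Every vertex lies in the tree of one root: count each subtree at its parent. -/
theorem sum_roots_le [Fintype V] [DecidableEq V] :
    ∑ r with par r = none, (1 + (K r).sum) ≤ Fintype.card V := by
  classical
  let g : V → ℕ := fun v => 1 + (K v).sum
  let D : Finset (Σ v, Fin (M.deg v)) := Finset.univ.filter fun x => M.IsChild par x.1 x.2
  have hinj : Set.InjOn (fun x : Σ v, Fin (M.deg v) => M.nbr x.1 x.2) D := by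
    rintro ⟨v, i⟩ hx ⟨v', i'⟩ hx' h
    simp only [D, Finset.coe_filter, Finset.mem_univ, true_and, Set.mem_ofPred_eq] at hx hx' h
    unfold IsChild at hx hx'
    have hb : (M.backPort v i : ℕ) = M.backPort v' i' :=
      Option.some_injective _ (hx.symm.trans ((congrArg par h).trans hx'))
    have hvv : v = v' := by
      rw [← M.nbr_backPort v i, ← M.nbr_backPort v' i']
      exact M.nbr_congr h hb
    subst hvv
    rw [M.nbr_injective v h]
  have hsum : ∑ v, g v = Fintype.card V + ∑ x ∈ D, g (M.nbr x.1 x.2) := by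
    have : ∀ v, g v = 1 + ∑ i : Fin (M.deg v), if M.IsChild par v i then g (M.nbr v i) else 0 := by
      intro v
      simp only [g]
      rw [hN.kids v, List.sum_ofFn]
    rw [Finset.sum_congr rfl fun v _ => this v, Finset.sum_add_distrib]
    simp only [Finset.sum_const, Finset.card_univ, smul_eq_mul, mul_one, D, Finset.sum_filter]
    rw [← Finset.univ_sigma_univ, Finset.sum_sigma]
  have hD : ∑ x ∈ D, g (M.nbr x.1 x.2) ≤ ∑ u with ¬ par u = none, g u := by
    rw [← Finset.sum_image (f := g) hinj]
    refine Finset.sum_le_sum_of_subset fun u hu => ?_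
    obtain ⟨x, hx, rfl⟩ := Finset.mem_image.1 hu
    simp only [D, Finset.mem_filter, Finset.mem_univ, true_and] at hx ⊢
    rw [hx]
    simp
  have := Finset.sum_filter_add_sum_filter_not Finset.univ (fun v => par v = none) g
  change ∑ r with par r = none, g r ≤ _
  omega

theorem off_add_le_card [Fintype V] (hF : M.IsForest T lead par lvl) (v : V) :
    off v + (1 + (K v).sum) ≤ Fintype.card V := by
  classical
  obtain ⟨r, hr, -, hro⟩ := hN.exists_root hF v
  exact hro.trans ((Finset.single_le_sum (f := fun r => 1 + (K r).sum) (fun _ _ => Nat.zero_le _)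
    (by simpa using hr)).trans hN.sum_roots_le)

theorem card_blocks_le [Fintype V] [DecidableEq V] (hF : M.IsForest T lead par lvl) {s : ℕ}
    (hs : 0 < s) :
    (Finset.univ.image fun v => Nat.pair (lead v) (off v / s)).card ≤
      1 + (Finset.univ.filter fun r => lead r ≠ 0 ∧ par r = none).card + Fintype.card V / s := by
  set R := Finset.univ.filter fun r => lead r ≠ 0 ∧ par r = none with hR
  have hsub : (Finset.univ.image fun v => Nat.pair (lead v) (off v / s)) ⊆
      insert (Nat.pair 0 0) (R.biUnion fun r =>
        (Finset.range ((1 + (K r).sum) / s + 1)).image (Nat.pair (lead r))) := by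
    intro y hy
    obtain ⟨v, -, rfl⟩ := Finset.mem_image.1 hy
    rw [Finset.mem_insert]
    by_cases h0 : lead v = 0
    · left
      have : par v = none := by
        by_contra hc
        exact hF.lead_ne v hc h0
      rw [hN.off_root v this, h0, Nat.zero_div]
    · right
      obtain ⟨r, hr, hrl, hro⟩ := hN.exists_root hF v
      rw [Finset.mem_biUnion]
      refine ⟨r, by simp [hR, hr, hrl, h0], ?_⟩
      rw [← hrl]
      refine Finset.mem_image_of_mem _ ?_
      rw [Finset.mem_range, Nat.lt_succ_iff]
      exact Nat.div_le_div_right (by omega)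
  calc _ ≤ _ := Finset.card_le_card hsub
    _ ≤ (∑ r ∈ R, ((1 + (K r).sum) / s + 1)) + 1 := by
      refine (Finset.card_insert_le _ _).trans (Nat.add_le_add_right ?_ 1)
      refine Finset.card_biUnion_le.trans (Finset.sum_le_sum fun r _ => ?_)
      exact Finset.card_image_le.trans (by simp)
    _ = (∑ r ∈ R, (1 + (K r).sum) / s) + R.card + 1 := by
      rw [Finset.sum_add_distrib]; simp
    _ ≤ Fintype.card V / s + R.card + 1 := by
      gcongr
      rw [Nat.le_div_iff_mul_le hs, Finset.sum_mul]
      calc _ ≤ ∑ r ∈ R, (1 + (K r).sum) :=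
            Finset.sum_le_sum fun r _ => Nat.div_mul_le_self _ _
        _ ≤ ∑ r with par r = none, (1 + (K r).sum) :=
            Finset.sum_le_sum_of_subset fun r hr => by
              simp only [hR, Finset.mem_filter, Finset.mem_univ, true_and] at hr ⊢
              exact hr.2
        _ ≤ _ := hN.sum_roots_le
    _ = _ := by omega

theorem card_block_le [Fintype V] [DecidableEq V] (hF : M.IsForest T lead par lvl) {s : ℕ}
    (hs : 0 < s) {v : V} (hv : lead v ≠ 0) :
    (Finset.univ.filter fun x =>
      Nat.pair (lead x) (off x / s) = Nat.pair (lead v) (off v / s)).card ≤ s := by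
  refine (Finset.card_le_card_of_injOn (t := Finset.Ico (off v / s * s) (off v / s * s + s))
    off ?_ ?_).trans (by simp)
  · intro x hx
    simp only [Finset.coe_filter, Finset.mem_univ, true_and, Set.mem_ofPred_eq,
      Nat.pair_eq_pair] at hx
    rw [Finset.mem_coe, Finset.mem_Ico, ← hx.2]
    refine ⟨Nat.div_mul_le_self _ _, ?_⟩
    have := Nat.lt_mul_div_succ (off x) hs
    rwa [Nat.mul_succ, mul_comm] at this
  · intro x hx y hy hxy
    simp only [Finset.coe_filter, Finset.mem_univ, true_and, Set.mem_ofPred_eq,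
      Nat.pair_eq_pair] at hx hy
    exact hN.off_injective hF (hx.1.trans hy.1.symm) (by rwa [hx.1]) hxy

end IsNumbering

end Network

/-! ### Computing the numbering and the blocks in the trees -/

namespace Node

/-- Every vertex tells its parent the size of its subtree, as far as it is known. -/
def count : Round Node where
  send x i := if x.par = some i then 1 + x.kids.sum else 0
  recv x l := { x with kids := l }

/-- Every vertex tells its children where their intervals of numbers begin. A block consists of
`thr` consecutive numbers of a tree. -/
def place : Round Node where
  send x i := x.off + 1 + (x.kids.take i).sum
  recv x l :=
    { x with
      off := match x.par with
        | none => 0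
        | some k => l.getD k 0
      label := Nat.pair x.lead ((match x.par with
        | none => 0
        | some k => l.getD k 0) / x.thr) }

/-- The computation of blocks from identifiers of at most `K` bits. -/
def blocks (K : ℕ) : List (Round Node) :=
  ruling K ++ ((List.range (2 * K)).flatMap fun _ => [grow]) ++
    ((List.range (2 * K + 1)).flatMap fun _ => [count]) ++
    ((List.range (2 * K + 1)).flatMap fun _ => [place])

end Node

namespace Network

variable {V : Type*} (M : Network V)

/-- The subtrees are counted up to depth `j`. -/
def Counted (lead : V → ℕ) (par : V → Option ℕ) (s j : ℕ) (σ : V → Node) : Prop :=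
  M.Static s σ ∧ ∀ v, (σ v).lead = lead v ∧ (σ v).par = par v ∧ (σ v).off = 0 ∧
    (σ v).kids = M.kidSizes par j v

/-- The vertices are numbered up to depth `j`. -/
def Placed (lead : V → ℕ) (par : V → Option ℕ) (K : V → List ℕ) (s j : ℕ) (σ : V → Node) :
    Prop :=
  M.Static s σ ∧ ∀ v, (σ v).lead = lead v ∧ (σ v).par = par v ∧ (σ v).kids = K v ∧
    (σ v).off = M.preorder par K j v ∧
    (0 < j → (σ v).label = Nat.pair (lead v) (M.preorder par K j v / s))

variable {M} {T s B : ℕ} {lead : V → ℕ} {par : V → Option ℕ} {lvl : V → ℕ} {K : V → List ℕ}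
  {off : V → ℕ}

theorem sum_kidSizes_monotone (v : V) : Monotone fun j => (M.kidSizes par j v).sum :=
  monotone_nat_of_le_succ fun j => sum_kidSizes_mono j v

theorem runs_count [Fintype V] (hF : M.IsForest T lead par lvl)
    (hB : Nat.size (Fintype.card V) ≤ B) {j : ℕ} (hj : j < T + 1) :
    M.Runs B (M.Counted lead par s j) [Node.count] (M.Counted lead par s (j + 1)) := by
  classical
  refine runs_single fun σ ⟨h1, h2⟩ => ⟨fun v i => (Nat.size_le_size ?_).trans hB, h1, fun v => ?_⟩
  · simp only [Node.count, (h2 v).2.2.2]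
    split_ifs
    · have := hF.isNumbering.off_add_le_card hF v
      have hm := sum_kidSizes_monotone (M := M) (par := par) v hj.le
      simp only at hm
      omega
    · exact Nat.zero_le _
  · refine ⟨(h2 v).1, (h2 v).2.1, (h2 v).2.2.1, ?_⟩
    simp only [step, Node.count, kidSizes]
    congr 1
    funext i
    rw [(h2 _).2.1, (h2 _).2.2.2]
    exact if_congr Iff.rfl rfl rfl

theorem IsNumbering.preorder_add_le_card [Fintype V] (hN : M.IsNumbering par K off)
    (hF : M.IsForest T lead par lvl) (j : ℕ) (v : V) :
    M.preorder par K j v + (1 + (K v).sum) ≤ Fintype.card V := by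
  have h0 := hN.off_add_le_card hF v
  induction j generalizing v with
  | zero => rw [preorder]; omega
  | succ j ih =>
    rw [preorder]
    cases hp : par v with
    | none => simp only; omega
    | some k =>
      obtain ⟨i, rfl, -⟩ := hF.parent v k hp
      simp only [getD_ofFn _ _ i]
      have h1 := hN.off_child v i hp
      have h2 := hN.nested ⟨i, hp, rfl⟩
      have h3 := ih (M.nbr v i) (hN.off_add_le_card hF _)
      omega

theorem runs_place [Fintype V] (hN : M.IsNumbering par K off) (hF : M.IsForest T lead par lvl)
    (hB : Nat.size (Fintype.card V) ≤ B) (j : ℕ) :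
    M.Runs B (M.Placed lead par K s j) [Node.place] (M.Placed lead par K s (j + 1)) := by
  refine runs_single fun σ ⟨h1, h2⟩ => ⟨fun v i => (Nat.size_le_size ?_).trans hB, h1, fun v => ?_⟩
  · simp only [Node.place, (h2 v).2.2.1, (h2 v).2.2.2.1]
    have := hN.preorder_add_le_card hF j v
    have h3 : ((K v).take i).sum ≤ (K v).sum := (List.take_sublist _ _).sum_le_sum (by simp)
    omega
  · have hoff : (M.step Node.place σ v).off = M.preorder par K (j + 1) v := by
      simp only [step, Node.place, preorder, (h2 v).2.1]
      cases par v with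
      | none => rfl
      | some k => simp only [(h2 _).2.2.1, (h2 _).2.2.2.1]
    refine ⟨(h2 v).1, (h2 v).2.1, (h2 v).2.2.1, hoff, fun _ => ?_⟩
    rw [← hoff, ← (h2 v).1, ← (h1 v).1]
    rfl

/-- The program `Node.blocks` computes `O(√n)` blocks. Those with vertices of large degree are
small, since these vertices are at distance at most `2 * k` from a root and hence in a tree; the vertices
in no tree form one block, which may be large. -/
theorem runs_blocks [Fintype V] [DecidableEq V] {κ : InitialKnowledge} {N k : ℕ}
    (hk : ∀ v, Nat.size (M.ident v) ≤ k) (hB : ∀ v, Nat.size (M.ident v + 1) ≤ B)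
    (hB' : Nat.size (Fintype.card V) ≤ B) :
    ∃ lead off : V → ℕ,
      let β : V → ℕ := fun v => Nat.pair (lead v) (off v / (Nat.sqrt N + 1))
      M.Runs B (fun σ => σ = Round.start Node.init κ M N) (Node.blocks k)
        (M.Labelled (Nat.sqrt N + 1) β) ∧
      (∀ v, Nat.size (lead v) ≤ B ∧ off v ≤ Fintype.card V) ∧
      (Finset.univ.image β).card ≤ 1 + 2 * (Fintype.card V / (Nat.sqrt N + 1)) ∧
      ∀ v, Nat.sqrt N + 1 ≤ M.deg v →
        (Finset.univ.filter fun x => β x = β v).card ≤ Nat.sqrt N + 1 := by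
  set s := Nat.sqrt N + 1 with hs
  have hone : V → 1 ≤ B := fun v =>
    (Nat.size_pos.2 (Fintype.card_pos_iff.2 ⟨v⟩)).trans_le hB'
  obtain ⟨hfit₁, hrul⟩ := runs_ruling hone k _ (ruling_start (M := M) (κ := κ) (N := N))
  set σ₁ := M.exec (Node.ruling k) (Round.start Node.init κ M N) with hσ₁
  obtain ⟨hfit₂, hgrown⟩ := runs_grow_loop hB (2 * k) _ hrul.grown
  set σ₂ := M.exec ((List.range (2 * k)).flatMap fun _ => [Node.grow]) σ₁ with hσ₂
  obtain ⟨lvl, hF⟩ := hgrown.forest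
  set lead : V → ℕ := fun v => (σ₂ v).lead with hlead
  set par : V → Option ℕ := fun v => (σ₂ v).par with hpar
  have hN := hF.isNumbering
  set K := M.kidSizes par (2 * k + 1)
  set off := M.preorder par K (2 * k + 1)
  refine ⟨lead, off, ?_, fun v => ⟨?_, ?_⟩, ?_, fun v hv => hN.card_block_le hF (Nat.succ_pos _) ?_⟩
  · have hc : M.Runs B (M.Counted lead par s 0)
        ((List.range (2 * k + 1)).flatMap fun _ => [Node.count])
        (M.Counted lead par s (2 * k + 1)) :=
      runs_loop _ fun j hj => runs_count hF hB' hj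
    have hp : M.Runs B (M.Placed lead par K s 0)
        ((List.range (2 * k + 1)).flatMap fun _ => [Node.place])
        (M.Placed lead par K s (2 * k + 1)) :=
      runs_loop _ fun j _ => runs_place hN hF hB' j
    have h12 : M.Runs B (fun σ => σ = Round.start Node.init κ M N)
        (Node.ruling k ++ (List.range (2 * k)).flatMap fun _ => [Node.grow])
        (M.Counted lead par s 0) := by
      rintro σ rfl
      rw [fits_append, exec_append]
      exact ⟨⟨hfit₁, hfit₂⟩, hgrown.static,
        fun v => ⟨rfl, rfl, (hgrown.fresh v).2, (hgrown.fresh v).1⟩⟩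
    refine ((h12.append hc).append (hp.weaken ?_ fun _ => id)).weaken (fun _ => id) ?_
    · exact fun σ ⟨h1, h2⟩ => ⟨h1, fun v => ⟨(h2 v).1, (h2 v).2.1, (h2 v).2.2.2,
        (h2 v).2.2.1, fun h => absurd h (lt_irrefl 0)⟩⟩
    · exact fun σ ⟨h1, h2⟩ => ⟨h1, fun v => (h2 v).2.2.2.2 (Nat.succ_pos _)⟩
  · by_cases h0 : lead v = 0
    · simp [h0]
    · obtain ⟨r, hr⟩ := hF.lead_eq v h0
      rw [hr]
      exact hB r
  · have := hN.off_add_le_card hF v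
    omega
  · have hR : (Finset.univ.filter fun r => lead r ≠ 0 ∧ par r = none).card ≤
        Fintype.card V / s := by
      rw [Nat.le_div_iff_mul_le (Nat.succ_pos _)]
      have := hrul.card_mul_le hk
      rwa [Finset.filter_congr fun v _ => hgrown.root v] at this
    have := hN.card_blocks_le hF (s := s) (Nat.succ_pos _)
    omega
  · obtain ⟨r, hr, p, hp⟩ := hrul.near v hv
    exact hgrown.cover v r hr ⟨p, hp⟩

end Network

/-! ### Identifiers of logarithmic length -/

theorem size_succ_le (x : ℕ) : Nat.size (x + 1) ≤ Nat.size x + 1 := by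
  rw [Nat.size_le, pow_succ]
  have := Nat.lt_size_self x
  omega

theorem size_le_log {n : ℕ} (hn : 2 ≤ n) : (Nat.size n : ℝ) ≤ 3 * Real.log n := by
  obtain ⟨k, hk⟩ : ∃ k, Nat.size n = k + 1 :=
    Nat.exists_eq_succ_of_ne_zero (Nat.size_pos.2 (by omega)).ne'
  have hpow : 2 ^ k ≤ n := Nat.lt_size.1 (by omega)
  have h1 : (k : ℝ) * Real.log 2 ≤ Real.log n := by
    rw [← Real.log_pow]
    exact Real.log_le_log (by positivity) (by exact_mod_cast hpow)
  have h2 : Real.log 2 ≤ Real.log n := Real.log_le_log (by norm_num) (by exact_mod_cast hn)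
  have h3 := Real.log_two_gt_d9
  rw [hk]
  push_cast
  nlinarith [Nat.cast_nonneg (α := ℝ) k]

theorem length_blocks (K : ℕ) : (Node.blocks K).length = 8 * K + 2 := by
  simp [Node.blocks, Node.ruling, List.length_flatMap]
  ring

theorem size_estimate_le {a n N : ℕ} (h : ApproximatesWithin a n N) (hn : 0 < n) :
    Nat.size (a * N) ≤ (2 * Nat.size a + 1) * Nat.size n := by
  have h1 : Nat.size (a * N) ≤ Nat.size a + (Nat.size a + Nat.size n) :=
    (Nat.size_le_size (Nat.mul_le_mul_left a h.2)).trans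
      ((size_mul_le _ _).trans (Nat.add_le_add_left (size_mul_le _ _) _))
  have h2 := Nat.size_pos.2 hn
  nlinarith [Nat.zero_le (Nat.size a)]

/-- The bound `c * Nat.size (a * N)` on the lengths of the identifiers is known to all vertices and
is `O(log n)`; each phase of the computation takes a number of rounds linear in it. -/
theorem exists_algorithm_logarithmic (a c : ℕ) :
    ∃ (A : DistAlgorithm) (C : ℕ),
      ∀ (V : Type u) [Fintype V] (M : Network V) (N : ℕ),
        ApproximatesWithin a (Fintype.card V) N →
        (∀ v, Nat.size (M.ident v) ≤ c * Nat.size (Fintype.card V)) →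
          (2 ≤ Fintype.card V → (A.rounds N : ℝ) ≤ C * Real.log (Fintype.card V)) ∧
          A.ConstructsSparse3Spanner .portsOnly M N C ∧
          A.EndpointsAgree .portsOnly M N := by
  refine ⟨Node.algorithm fun N => Node.blocks (c * Nat.size (a * N)) ++
      ([Node.introduce] ++ [Node.nominate] ++ [Node.announce]),
    3 * (8 * (c * (2 * Nat.size a + 1)) + 5) + 4 * (c + 1) + (3 * a + 2), ?_⟩
  intro V _ M N hN hid
  classical
  refine ⟨fun hn => ?_, ?_⟩
  · have hlen : (Node.blocks (c * Nat.size (a * N)) ++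
        ([Node.introduce] ++ [Node.nominate] ++ [Node.announce])).length
        ≤ (8 * (c * (2 * Nat.size a + 1)) + 5) * Nat.size (Fintype.card V) := by
      rw [List.length_append, length_blocks]
      have h1 := Nat.mul_le_mul_left c (size_estimate_le hN (by omega))
      have h2 : 0 < Nat.size (Fintype.card V) := Nat.size_pos.2 (by omega)
      simp only [List.length_append, List.length_singleton]
      nlinarith
    have hlog := size_le_log hn
    have hpos : 0 ≤ Real.log (Fintype.card V) := Real.log_natCast_nonneg _
    calc _ ≤ (((8 * (c * (2 * Nat.size a + 1)) + 5) * Nat.size (Fintype.card V) : ℕ) : ℝ) :=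
          Nat.cast_le.2 hlen
      _ = ((8 * (c * (2 * Nat.size a + 1)) + 5 : ℕ) : ℝ) * Nat.size (Fintype.card V) := by
          push_cast; ring
      _ ≤ ((8 * (c * (2 * Nat.size a + 1)) + 5 : ℕ) : ℝ) *
            (3 * Real.log (Fintype.card V)) := by gcongr
      _ = ((3 * (8 * (c * (2 * Nat.size a + 1)) + 5) : ℕ) : ℝ) *
            Real.log (Fintype.card V) := by push_cast; ring
      _ ≤ _ := by gcongr; omega
  rcases Nat.eq_zero_or_pos (Fintype.card V) with hn | hn
  · have : IsEmpty V := Fintype.card_eq_zero_iff.1 hn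
    exact ⟨constructsSparse3Spanner_of_isEmpty, fun v => isEmptyElim v⟩
  have hz : 0 < Nat.size (Fintype.card V) := Nat.size_pos.2 hn
  set z := Nat.size (Fintype.card V) with hzdef
  have hk : ∀ v, Nat.size (M.ident v) ≤ c * Nat.size (a * N) := fun v =>
    (hid v).trans (Nat.mul_le_mul_left c (Nat.size_le_size hN.1))
  have hsucc : ∀ v, Nat.size (M.ident v + 1) ≤ (c + 1) * z := fun v => by
    have := size_succ_le (M.ident v)
    have := hid v
    nlinarith
  have hcard : Nat.size (Fintype.card V) ≤ (c + 1) * z := by nlinarith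
  obtain ⟨lead, off, hrun, hbd, hq, hs⟩ :=
    Network.runs_blocks (κ := .portsOnly) (N := N) (B := (c + 1) * z) hk hsucc hcard
  set β : V → ℕ := fun v => Nat.pair (lead v) (off v / (Nat.sqrt N + 1))
  have hident : ∀ v, Nat.size (M.ident v) ≤ (c + 1) * z := fun v =>
    (Nat.size_le_size (Nat.le_succ _)).trans (hsucc v)
  have hfull : M.Runs (2 * (2 * ((c + 1) * z)))
      (fun σ => σ = Round.start Node.init .portsOnly M N)
      (Node.blocks (c * Nat.size (a * N)) ++
        ([Node.introduce] ++ [Node.nominate] ++ [Node.announce])) _ :=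
    (hrun.mono_bits (by omega)).append
      (((Network.runs_introduce fun v => size_pair_le
          (size_pair_le (hbd v).1 ((Nat.size_le_size
            ((Nat.div_le_self _ _).trans (hbd v).2)).trans hcard))
          ((hident v).trans (by omega))).append
        (Network.runs_nominate fun v => (hident v).trans (by omega))).append
        (Network.runs_announce fun _ => by nlinarith))
  refine ⟨Network.constructsSparse3Spanner (P := fun σ => σ = _) rfl
    (hfull.weaken (fun _ => id) fun σ => Network.selGraph_decide_of_announced) ?_ hq hs ?_,
    Network.endpointsAgree (P := fun σ => σ = _) rfl hfull⟩
  · calc 2 * (2 * ((c + 1) * z)) = (4 * (c + 1)) * z := by ring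
      _ ≤ _ := Nat.mul_le_mul_right _ (by omega)
  · have h1 := threshold_le hN hn
    have h2 := div_threshold_le hN
    have h3 : (1 : ℝ) ≤ √(Fintype.card V) := by rw [Real.one_le_sqrt]; exact_mod_cast hn
    calc ((1 + 2 * (Fintype.card V / (Nat.sqrt N + 1)) + (Nat.sqrt N + 1) : ℕ) : ℝ)
        = 1 + 2 * ((Fintype.card V / (Nat.sqrt N + 1) : ℕ) : ℝ) + ((Nat.sqrt N + 1 : ℕ) : ℝ) := by
          push_cast; ring
      _ ≤ ((3 * a + 2 : ℕ) : ℝ) * √(Fintype.card V) := by push_cast at h1 h2 ⊢; nlinarith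
      _ ≤ _ := mul_le_mul_of_nonneg_right (Nat.cast_le.2 (by omega)) (Real.sqrt_nonneg _)

theorem theorem2 (a c : ℕ) :
    -- arbitrary identifiers of `O(log n)` bits: `O(log n)` rounds
    (∃ (A : DistAlgorithm) (C : ℕ),
      ∀ (V : Type u) [Fintype V] (M : Network V) (N : ℕ),
        ApproximatesWithin a (Fintype.card V) N →
        (∀ v, Nat.size (M.ident v) ≤ c * Nat.size (Fintype.card V)) →
          (2 ≤ Fintype.card V → (A.rounds N : ℝ) ≤ C * Real.log (Fintype.card V)) ∧
          A.ConstructsSparse3Spanner .portsOnly M N C ∧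
          A.EndpointsAgree .portsOnly M N) ∧
    -- identifiers in `[1, O(n)]`: two rounds, if each edge is to be known to one endpoint
    (∃ (A : DistAlgorithm) (C : ℕ), (∀ N, A.rounds N = 2) ∧
      ∀ (V : Type u) [Fintype V] (M : Network V) (N : ℕ),
        ApproximatesWithin a (Fintype.card V) N →
        (∀ v, 1 ≤ M.ident v ∧ M.ident v ≤ c * Fintype.card V) →
          A.ConstructsSparse3Spanner .portsOnly M N C) ∧
    -- and also if vertices initially know the identifiers of their neighbors and each edge is to
    -- be known to both endpoints
    (∃ (A : DistAlgorithm) (C : ℕ), (∀ N, A.rounds N = 2) ∧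
      ∀ (V : Type u) [Fintype V] (M : Network V) (N : ℕ),
        ApproximatesWithin a (Fintype.card V) N →
        (∀ v, 1 ≤ M.ident v ∧ M.ident v ≤ c * Fintype.card V) →
          A.ConstructsSparse3Spanner .neighborIdents M N C ∧
          A.EndpointsAgree .neighborIdents M N) :=
  ⟨exists_algorithm_logarithmic a c, exists_algorithm_portsOnly a c,
    exists_algorithm_neighborIdents a c⟩
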